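/- \textbf{Terms.} Let $S$ be a set of name sorts. Types are generated by $T ::= \diamond \mid T\to\diamond \mid s\to\diamond$ ($s\in S$): non-abstractions, process-abstractions and name-abstractions. Fix a map $\mathrm{ob}$ from $S$ \emph{onto} the set of types; names of sort $s$ carry terms of type $\mathrm{ob}(s)$. Each sort has infinitely many name constants and name variables ($x,y$); $m,n,d$ range over all names; process variables $X,Y$ are typed. The terms of HOmp are the well-typed expressions, up to $\alpha$-conversion, of $$P,Q ::= 0 \mid X \mid m(X).P \mid \overline m(Q) \mid P\,|\,Q \mid \langle X\rangle P \mid P\langle Q\rangle \mid \langle x\rangle P \mid P\langle n\rangle ,$$ where $0$, $m(X).P$, $\overline m(Q)$, $P|Q$ and both applications have type $\diamond$; the components of $P|Q$ and the bodies of input prefixes and of abstractions have type $\diamond$; for $m$ of sort $s$, $X$ in $m(X).P$ and $Q$ in $\overline m(Q)$ have type $\mathrm{ob}(s)$; $\langle X\rangle P$ has type $T\to\diamond$ for $X$ of type $T$, $\langle x\rangle P$ has type $s\to\diamond$ for $x$ of sort $s$, and applications respect these types. A term is closed if it has no free process variable. Substitutions respect types and sorts. \textbf{Semantics.} $\equiv$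 is the least congruence on terms such that $|$ is associative and commutative with unit $0$, $(\langle X\rangle P)\langle Q\rangle\equiv P\{Q/X\}$ and $(\langle x\rangle P)\langle n\rangle\equiv P\{n/x\}$. Transitions $P\xrightarrow{\lambda}P'$ with $\lambda = m(X),\overline m(A),\tau$ are the least relations such that $m(X).P\xrightarrow{m(X)}P$; $\overline m(Q)\xrightarrow{\overline m(Q)}0$; if $P\xrightarrow{\lambda}P'$ then $P|Q\xrightarrow{\lambda}P'|Q$ (the variable bound by $\lambda$ not free in $Q$) and symmetrically; if $P\xrightarrow{\overline m(A)}P'$ and $Q\xrightarrow{m(X)}Q'$ then $P|Q\xrightarrow{\tau}P'|Q'\{A/X\}$ and symmetrically; if $Q\equiv P\xrightarrow{\lambda}P'\equiv Q'$ then $Q\xrightarrow{\lambda}Q'$. \textbf{Bisimilarities.} All relations are between terms of equal type. A symmetric relation $\mathcal R$ on closed terms is a strong HO bisimulation if $P\,\mathcal R\,Q$ implies: if $P=\langle Y\rangle P'$ then $Q=\langle Y\rangle Q'$ with $P'\{A/Y\}\,\mathcal R\,Q'\{A/Y\}$ for every closed $A$; if $P=\langle y\rangle A$ then $Q=\langle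 y\rangle B$ with $A\,\mathcal R\,B$; if $P\xrightarrow{\overline m(A)}P'$ then $Q\xrightarrow{\overline m(B)}Q'$ with $A\,\mathcal R\,B$, $P'\,\mathcal R\,Q'$; if $P\xrightarrow{m(X)}P'$ then $Q\xrightarrow{m(X)}Q'$ with $P'\{A/X\}\,\mathcal R\,Q'\{A/X\}$ for every closed $A$; if $P\xrightarrow{\tau}P'$ then $Q\xrightarrow{\tau}Q'$ with $P'\,\mathcal R\,Q'$. Strong HO bisimilarity $\sim_{HO}$ is the largest strong HO bisimulation, extended to open terms by: $P\sim_{HO}Q$ iff $P\{\tilde R/\tilde X\}\sim_{HO}Q\{\tilde R/\tilde X\}$ for all closed $\tilde R$, where $\tilde X$ are the free process variables of $P,Q$. A symmetric relation $\mathcal R$ on (open or closed) terms is a strong HO-IO bisimulation if $P\,\mathcal R\,Q$ implies: if $P$ is a process-abstraction $\langle Y\rangle A$ then $Q$ is a process-abstraction $\langle Y\rangle B$ with $A\,\mathcal R\,B$; if $P$ is a name-abstraction $\langle y\rangle A$ then $Q$ is a name-abstraction $\langle y\rangle B$ with $A\,\mathcal R\,B$ (in these two clauses a process variable $X$ of abstraction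 type is read as $\langle Y\rangle(X\langle Y\rangle)$, respectively $\langle y\rangle(X\langle y\rangle)$); if $P\xrightarrow{\overline m(A)}P'$ then $Q\xrightarrow{\overline m(B)}Q'$ with $A\,\mathcal R\,B$, $P'\,\mathcal R\,Q'$; if $P\xrightarrow{m(X)}P'$ then $Q\xrightarrow{m(X)}Q'$ with $P'\,\mathcal R\,Q'$; if $P\equiv X\,|\,P'$ then $Q\equiv X\,|\,Q'$ with $P'\,\mathcal R\,Q'$; if $P\equiv X\langle A\rangle\,|\,P'$ then $Q\equiv X\langle B\rangle\,|\,Q'$ with $A\,\mathcal R\,B$, $P'\,\mathcal R\,Q'$; if $P\equiv X\langle d\rangle\,|\,P'$ then $Q\equiv X\langle d\rangle\,|\,Q'$ with $P'\,\mathcal R\,Q'$. Strong HO-IO bisimilarity $\sim_{HOIO}$ is the largest strong HO-IO bisimulation. \textbf{Lemma.} On all HOmp terms, open and closed, $\sim_{HO}\;=\;\sim_{HOIO}$: for all terms $P,Q$ of the same type, $P\sim_{HO}Q$ if and only if $P\sim_{HOIO}Q$. -/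

import Mathlib

namespace HOmp

universe u

/-- Types of terms over a set `S` of name sorts: non-abstractions (processes), process-abstractions
taking an argument of type `T`, and name-abstractions taking a name of sort `s`.
The body of an abstraction is a process. Being inductive, the types have finite order. -/
inductive Ty (S : Type u) : Type u
  | proc : Ty S
  | pabs : Ty S → Ty S
  | nabs : S → Ty S

/-- `Var l a`: a variable of sort or type `a` in the scope `l` (a de Bruijn index). -/
inductive Var {α : Type u} : List α → α → Type u
  | zero {a : α} {l : List α} : Var (a :: l) a
  | succ {a b : α} {l : List α} : Var l a → Var (b :: l) a

/-- Names of sort `s`: one of infinitely many name constants, or a name variable in scope. -/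
inductive Nm {S : Type u} (Δ : List S) (s : S) : Type u
  | const : ℕ → Nm Δ s
  | var : Var Δ s → Nm Δ s

/-- Well-typed terms (up to α-conversion) with free name variables in `Δ` and free process
variables in `Γ`. The function `ob` is the sorting: a name of sort `s` carries terms of type
`ob s`. A term is closed when `Γ = []`. -/
inductive Tm {S : Type u} (ob : S → Ty S) : List S → List (Ty S) → Ty S → Type u
  | nil {Δ : List S} {Γ : List (Ty S)} : Tm ob Δ Γ Ty.proc
  | var {Δ : List S} {Γ : List (Ty S)} {T : Ty S} : Var Γ T → Tm ob Δ Γ T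
  | inp {Δ : List S} {Γ : List (Ty S)} {s : S} :
      Nm Δ s → Tm ob Δ (ob s :: Γ) Ty.proc → Tm ob Δ Γ Ty.proc
  | out {Δ : List S} {Γ : List (Ty S)} {s : S} :
      Nm Δ s → Tm ob Δ Γ (ob s) → Tm ob Δ Γ Ty.proc
  | par {Δ : List S} {Γ : List (Ty S)} :
      Tm ob Δ Γ Ty.proc → Tm ob Δ Γ Ty.proc → Tm ob Δ Γ Ty.proc
  | pabs {Δ : List S} {Γ : List (Ty S)} {T : Ty S} :
      Tm ob Δ (T :: Γ) Ty.proc → Tm ob Δ Γ (Ty.pabs T)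
  | papp {Δ : List S} {Γ : List (Ty S)} {T : Ty S} :
      Tm ob Δ Γ (Ty.pabs T) → Tm ob Δ Γ T → Tm ob Δ Γ Ty.proc
  | nabs {Δ : List S} {Γ : List (Ty S)} {s : S} :
      Tm ob (s :: Δ) Γ Ty.proc → Tm ob Δ Γ (Ty.nabs s)
  | napp {Δ : List S} {Γ : List (Ty S)} {s : S} :
      Tm ob Δ Γ (Ty.nabs s) → Nm Δ s → Tm ob Δ Γ Ty.proc

/-! ### Substitution -/

/-- Simultaneous substitutions of names for name variables. -/
def NSub {S : Type u} (Δ Δ' : List S) : Type u := ∀ s : S, Var Δ s → Nm Δ' s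

def Nm.nsub {S : Type u} {Δ Δ' : List S} (ρ : NSub Δ Δ') {s : S} : Nm Δ s → Nm Δ' s
  | .const n => .const n
  | .var x => ρ s x

def NSub.wk {S : Type u} {Δ : List S} (s : S) : NSub Δ (s :: Δ) := fun _ x => .var x.succ

def NSub.lift {S : Type u} {Δ Δ' : List S} (ρ : NSub Δ Δ') (s : S) :
    NSub (s :: Δ) (s :: Δ')
  | _, .zero => .var .zero
  | _, .succ x => (ρ _ x).nsub (NSub.wk s)

/-- The substitution `{n/x}` of a name for the most recently bound name variable. -/
def NSub.single {S : Type u} {Δ : List S} {s : S} (n : Nm Δ s) : NSub (s :: Δ) Δ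
  | _, .zero => n
  | _, .succ x => .var x

/-- Renamings of process variables. -/
def Ren {S : Type u} (Γ Γ' : List (Ty S)) : Type u := ∀ T : Ty S, Var Γ T → Var Γ' T

def Ren.wk {S : Type u} {Γ : List (Ty S)} (T : Ty S) : Ren Γ (T :: Γ) := fun _ X => X.succ

def Ren.lift {S : Type u} {Γ Γ' : List (Ty S)} (r : Ren Γ Γ') (T : Ty S) :
    Ren (T :: Γ) (T :: Γ')
  | _, .zero => .zero
  | _, .succ X => (r _ X).succ

section

variable {S : Type u} {ob : S → Ty S}

/-- Application of a name substitution to a term. -/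
def Tm.nsub {Δ Δ' : List S} {Γ : List (Ty S)} {T : Ty S} (ρ : NSub Δ Δ') :
    Tm ob Δ Γ T → Tm ob Δ' Γ T
  | .nil => .nil
  | .var X => .var X
  | .inp m P => .inp (m.nsub ρ) (P.nsub ρ)
  | .out m Q => .out (m.nsub ρ) (Q.nsub ρ)
  | .par P Q => .par (P.nsub ρ) (Q.nsub ρ)
  | .pabs P => .pabs (P.nsub ρ)
  | .papp P Q => .papp (P.nsub ρ) (Q.nsub ρ)
  | .nabs P => .nabs (P.nsub (ρ.lift _))
  | .napp P n => .napp (P.nsub ρ) (n.nsub ρ)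

/-- Renaming of the process variables of a term. -/
def Tm.ren {Δ : List S} {Γ Γ' : List (Ty S)} {T : Ty S} (r : Ren Γ Γ') :
    Tm ob Δ Γ T → Tm ob Δ Γ' T
  | .nil => .nil
  | .var X => .var (r _ X)
  | .inp m P => .inp m (P.ren (r.lift _))
  | .out m Q => .out m (Q.ren r)
  | .par P Q => .par (P.ren r) (Q.ren r)
  | .pabs P => .pabs (P.ren (r.lift _))
  | .papp P Q => .papp (P.ren r) (Q.ren r)
  | .nabs P => .nabs (P.ren r)
  | .napp P n => .napp (P.ren r) n

/-- Weakening: `P` seen in a scope with one more process variable, which does not occur in it. -/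
def Tm.wk {Δ : List S} {Γ : List (Ty S)} {U : Ty S} (T : Ty S) (P : Tm ob Δ Γ U) :
    Tm ob Δ (T :: Γ) U :=
  P.ren (Ren.wk T)

/-- Simultaneous substitutions of terms for process variables. -/
def PSub (ob : S → Ty S) (Δ : List S) (Γ Γ' : List (Ty S)) : Type u :=
  ∀ T : Ty S, Var Γ T → Tm ob Δ Γ' T

def PSub.lift {Δ : List S} {Γ Γ' : List (Ty S)} (σ : PSub ob Δ Γ Γ') (T : Ty S) :
    PSub ob Δ (T :: Γ) (T :: Γ')
  | _, .zero => .var .zero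
  | _, .succ X => (σ _ X).wk T

def PSub.nlift {Δ : List S} {Γ Γ' : List (Ty S)} (σ : PSub ob Δ Γ Γ') (s : S) :
    PSub ob (s :: Δ) Γ Γ' :=
  fun _ X => (σ _ X).nsub (NSub.wk s)

/-- The substitution `{Q/X}` of a term for the most recently bound process variable. -/
def PSub.single {Δ : List S} {Γ : List (Ty S)} {T : Ty S} (Q : Tm ob Δ Γ T) :
    PSub ob Δ (T :: Γ) Γ
  | _, .zero => Q
  | _, .succ X => .var X

/-- Application of a process substitution to a term. -/
def Tm.psub {Δ : List S} {Γ Γ' : List (Ty S)} {T : Ty S} (σ : PSub ob Δ Γ Γ') :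
    Tm ob Δ Γ T → Tm ob Δ Γ' T
  | .nil => .nil
  | .var X => σ _ X
  | .inp m P => .inp m (P.psub (σ.lift _))
  | .out m Q => .out m (Q.psub σ)
  | .par P Q => .par (P.psub σ) (Q.psub σ)
  | .pabs P => .pabs (P.psub (σ.lift _))
  | .papp P Q => .papp (P.psub σ) (Q.psub σ)
  | .nabs P => .nabs (P.psub (σ.nlift _))
  | .napp P n => .napp (P.psub σ) n

/-- `P{Q/X}`, where `X` is the most recently bound process variable of `P`. -/
def Tm.inst {Δ : List S} {Γ : List (Ty S)} {T U : Ty S} (P : Tm ob Δ (T :: Γ) U)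
    (Q : Tm ob Δ Γ T) : Tm ob Δ Γ U :=
  P.psub (PSub.single Q)

/-- `P{n/x}`, where `x` is the most recently bound name variable of `P`. -/
def Tm.ninst {Δ : List S} {Γ : List (Ty S)} {s : S} {U : Ty S} (P : Tm ob (s :: Δ) Γ U)
    (n : Nm Δ s) : Tm ob Δ Γ U :=
  P.nsub (NSub.single n)

/-! ### Structural congruence and transitions -/

/-- Structural congruence: the least congruence with the commutative monoid laws of parallel
composition and the two application laws. -/
inductive SC : {Δ : List S} → {Γ : List (Ty S)} → {T : Ty S} →
    Tm ob Δ Γ T → Tm ob Δ Γ T → Prop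
  | refl {Δ Γ T} (P : Tm ob Δ Γ T) : SC P P
  | symm {Δ Γ T} {P Q : Tm ob Δ Γ T} : SC P Q → SC Q P
  | trans {Δ Γ T} {P Q R : Tm ob Δ Γ T} : SC P Q → SC Q R → SC P R
  | inp {Δ Γ} {s : S} (m : Nm Δ s) {P P' : Tm ob Δ (ob s :: Γ) Ty.proc} :
      SC P P' → SC (Tm.inp m P) (Tm.inp m P')
  | out {Δ Γ} {s : S} (m : Nm Δ s) {Q Q' : Tm ob Δ Γ (ob s)} :
      SC Q Q' → SC (Tm.out m Q) (Tm.out m Q')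
  | par {Δ Γ} {P P' Q Q' : Tm ob Δ Γ Ty.proc} :
      SC P P' → SC Q Q' → SC (Tm.par P Q) (Tm.par P' Q')
  | pabs {Δ Γ T} {P P' : Tm ob Δ (T :: Γ) Ty.proc} :
      SC P P' → SC (Tm.pabs P) (Tm.pabs P')
  | papp {Δ Γ T} {P P' : Tm ob Δ Γ (Ty.pabs T)} {Q Q' : Tm ob Δ Γ T} :
      SC P P' → SC Q Q' → SC (Tm.papp P Q) (Tm.papp P' Q')
  | nabs {Δ Γ} {s : S} {P P' : Tm ob (s :: Δ) Γ Ty.proc} :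
      SC P P' → SC (Tm.nabs P) (Tm.nabs P')
  | napp {Δ Γ} {s : S} {P P' : Tm ob Δ Γ (Ty.nabs s)} (n : Nm Δ s) :
      SC P P' → SC (Tm.napp P n) (Tm.napp P' n)
  | par_assoc {Δ Γ} (P Q R : Tm ob Δ Γ Ty.proc) :
      SC (Tm.par (Tm.par P Q) R) (Tm.par P (Tm.par Q R))
  | par_comm {Δ Γ} (P Q : Tm ob Δ Γ Ty.proc) : SC (Tm.par P Q) (Tm.par Q P)
  | par_nil {Δ Γ} (P : Tm ob Δ Γ Ty.proc) : SC (Tm.par P Tm.nil) P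
  | pbeta {Δ Γ T} (P : Tm ob Δ (T :: Γ) Ty.proc) (Q : Tm ob Δ Γ T) :
      SC (Tm.papp (Tm.pabs P) Q) (P.inst Q)
  | nbeta {Δ Γ} {s : S} (P : Tm ob (s :: Δ) Γ Ty.proc) (n : Nm Δ s) :
      SC (Tm.napp (Tm.nabs P) n) (P.ninst n)

/-- Input transitions `P --m(X)--> P'`; the place-holder `X` is the new variable of `P'`. -/
inductive InStep {Δ : List S} {Γ : List (Ty S)} {s : S} (m : Nm Δ s) :
    Tm ob Δ Γ Ty.proc → Tm ob Δ (ob s :: Γ) Ty.proc → Prop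
  | inp (P : Tm ob Δ (ob s :: Γ) Ty.proc) : InStep m (Tm.inp m P) P
  | parL {P P'} (Q : Tm ob Δ Γ Ty.proc) :
      InStep m P P' → InStep m (Tm.par P Q) (Tm.par P' (Q.wk _))
  | parR {Q Q'} (P : Tm ob Δ Γ Ty.proc) :
      InStep m Q Q' → InStep m (Tm.par P Q) (Tm.par (P.wk _) Q')
  | struct {Q P P' Q'} : SC Q P → InStep m P P' → SC P' Q' → InStep m Q Q'

/-- Output transitions: `OutStep m A P P'` is `P --m̄(A)--> P'`. -/
inductive OutStep {Δ : List S} {Γ : List (Ty S)} {s : S} (m : Nm Δ s) (A : Tm ob Δ Γ (ob s)) :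
    Tm ob Δ Γ Ty.proc → Tm ob Δ Γ Ty.proc → Prop
  | out : OutStep m A (Tm.out m A) Tm.nil
  | parL {P P'} (Q : Tm ob Δ Γ Ty.proc) :
      OutStep m A P P' → OutStep m A (Tm.par P Q) (Tm.par P' Q)
  | parR {Q Q'} (P : Tm ob Δ Γ Ty.proc) :
      OutStep m A Q Q' → OutStep m A (Tm.par P Q) (Tm.par P Q')
  | struct {Q P P' Q'} : SC Q P → OutStep m A P P' → SC P' Q' → OutStep m A Q Q'

/-- Internal transitions `P --τ--> P'`. -/
inductive TauStep {Δ : List S} {Γ : List (Ty S)} :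
    Tm ob Δ Γ Ty.proc → Tm ob Δ Γ Ty.proc → Prop
  | comL {s : S} {m : Nm Δ s} {A : Tm ob Δ Γ (ob s)} {P P' Q : Tm ob Δ Γ Ty.proc}
      {Q' : Tm ob Δ (ob s :: Γ) Ty.proc} :
      OutStep m A P P' → InStep m Q Q' → TauStep (Tm.par P Q) (Tm.par P' (Q'.inst A))
  | comR {s : S} {m : Nm Δ s} {A : Tm ob Δ Γ (ob s)} {P Q Q' : Tm ob Δ Γ Ty.proc}
      {P' : Tm ob Δ (ob s :: Γ) Ty.proc} :
      InStep m P P' → OutStep m A Q Q' → TauStep (Tm.par P Q) (Tm.par (P'.inst A) Q')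
  | parL {P P'} (Q : Tm ob Δ Γ Ty.proc) :
      TauStep P P' → TauStep (Tm.par P Q) (Tm.par P' Q)
  | parR {Q Q'} (P : Tm ob Δ Γ Ty.proc) :
      TauStep Q Q' → TauStep (Tm.par P Q) (Tm.par P Q')
  | struct {Q P P' Q'} : SC Q P → TauStep P P' → SC P' Q' → TauStep Q Q'

/-! ### Strong HO-IO bisimilarity -/

/-- Reading a term of process-abstraction type as `⟨Y⟩A`, this is `A`.
A variable `X` of such a type is read as `⟨Y⟩(X⟨Y⟩)`. -/
def Tm.pbody {Δ : List S} {Γ : List (Ty S)} {T : Ty S} :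
    Tm ob Δ Γ (Ty.pabs T) → Tm ob Δ (T :: Γ) Ty.proc
  | .pabs A => A
  | .var X => .papp (.var X.succ) (.var .zero)

/-- Reading a term of name-abstraction type as `⟨y⟩A`, this is `A`.
A variable `X` of such a type is read as `⟨y⟩(X⟨y⟩)`. -/
def Tm.nbody {Δ : List S} {Γ : List (Ty S)} {s : S} :
    Tm ob Δ Γ (Ty.nabs s) → Tm ob (s :: Δ) Γ Ty.proc
  | .nabs A => A
  | .var X => .napp (.var X) (.var .zero)

/-- Strong HO-IO bisimulations. Relations hold between terms of the same type, so that a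
non-abstraction is only related to non-abstractions. -/
structure IsHOIOBisim
    (R : ∀ {Δ : List S} {Γ : List (Ty S)} {T : Ty S}, Tm ob Δ Γ T → Tm ob Δ Γ T → Prop) :
    Prop where
  symm : ∀ {Δ Γ T} {P Q : Tm ob Δ Γ T}, R P Q → R Q P
  pabs : ∀ {Δ Γ T} {P Q : Tm ob Δ Γ (Ty.pabs T)}, R P Q → R P.pbody Q.pbody
  nabs : ∀ {Δ Γ s} {P Q : Tm ob Δ Γ (Ty.nabs s)}, R P Q → R P.nbody Q.nbody
  out : ∀ {Δ Γ} {P Q : Tm ob Δ Γ Ty.proc}, R P Q →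
    ∀ {s} (m : Nm Δ s) (A : Tm ob Δ Γ (ob s)) (P' : Tm ob Δ Γ Ty.proc), OutStep m A P P' →
      ∃ (B : Tm ob Δ Γ (ob s)) (Q' : Tm ob Δ Γ Ty.proc), OutStep m B Q Q' ∧ R A B ∧ R P' Q'
  inp : ∀ {Δ Γ} {P Q : Tm ob Δ Γ Ty.proc}, R P Q →
    ∀ {s} (m : Nm Δ s) (P' : Tm ob Δ (ob s :: Γ) Ty.proc), InStep m P P' →
      ∃ Q' : Tm ob Δ (ob s :: Γ) Ty.proc, InStep m Q Q' ∧ R P' Q'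
  var : ∀ {Δ Γ} {P Q : Tm ob Δ Γ Ty.proc}, R P Q →
    ∀ (X : Var Γ Ty.proc) (P' : Tm ob Δ Γ Ty.proc), SC P (Tm.par (Tm.var X) P') →
      ∃ Q' : Tm ob Δ Γ Ty.proc, SC Q (Tm.par (Tm.var X) Q') ∧ R P' Q'
  papp : ∀ {Δ Γ} {P Q : Tm ob Δ Γ Ty.proc}, R P Q →
    ∀ {T} (X : Var Γ (Ty.pabs T)) (A : Tm ob Δ Γ T) (P' : Tm ob Δ Γ Ty.proc),
      SC P (Tm.par (Tm.papp (Tm.var X) A) P') →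
      ∃ (B : Tm ob Δ Γ T) (Q' : Tm ob Δ Γ Ty.proc),
        SC Q (Tm.par (Tm.papp (Tm.var X) B) Q') ∧ R A B ∧ R P' Q'
  napp : ∀ {Δ Γ} {P Q : Tm ob Δ Γ Ty.proc}, R P Q →
    ∀ {s} (X : Var Γ (Ty.nabs s)) (d : Nm Δ s) (P' : Tm ob Δ Γ Ty.proc),
      SC P (Tm.par (Tm.napp (Tm.var X) d) P') →
      ∃ Q' : Tm ob Δ Γ Ty.proc, SC Q (Tm.par (Tm.napp (Tm.var X) d) Q') ∧ R P' Q'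

/-- Strong HO-IO bisimilarity: the union of all strong HO-IO bisimulations. -/
def HOIOBisimilar {Δ : List S} {Γ : List (Ty S)} {T : Ty S} (P Q : Tm ob Δ Γ T) : Prop :=
  ∃ R : ∀ {Δ : List S} {Γ : List (Ty S)} {T : Ty S}, Tm ob Δ Γ T → Tm ob Δ Γ T → Prop,
    IsHOIOBisim R ∧ R P Q

/-! ### Strong HO bisimilarity -/

/-- Strong HO bisimulations, on closed terms. Relations hold between terms of the same type, so
that a non-abstraction is only related to non-abstractions. -/
structure IsHOBisim
    (R : ∀ {Δ : List S} {T : Ty S}, Tm ob Δ [] T → Tm ob Δ [] T → Prop) : Prop where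
  symm : ∀ {Δ T} {P Q : Tm ob Δ [] T}, R P Q → R Q P
  pabs : ∀ {Δ T} {P' : Tm ob Δ [T] Ty.proc} {Q : Tm ob Δ [] (Ty.pabs T)}, R (Tm.pabs P') Q →
    ∃ Q' : Tm ob Δ [T] Ty.proc, Q = Tm.pabs Q' ∧
      ∀ A : Tm ob Δ [] T, R (P'.inst A) (Q'.inst A)
  nabs : ∀ {Δ s} {A : Tm ob (s :: Δ) [] Ty.proc} {Q : Tm ob Δ [] (Ty.nabs s)},
    R (Tm.nabs A) Q → ∃ B : Tm ob (s :: Δ) [] Ty.proc, Q = Tm.nabs B ∧ R A B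
  out : ∀ {Δ} {P Q : Tm ob Δ [] Ty.proc}, R P Q →
    ∀ {s} (m : Nm Δ s) (A : Tm ob Δ [] (ob s)) (P' : Tm ob Δ [] Ty.proc), OutStep m A P P' →
      ∃ (B : Tm ob Δ [] (ob s)) (Q' : Tm ob Δ [] Ty.proc), OutStep m B Q Q' ∧ R A B ∧ R P' Q'
  inp : ∀ {Δ} {P Q : Tm ob Δ [] Ty.proc}, R P Q →
    ∀ {s} (m : Nm Δ s) (P' : Tm ob Δ [ob s] Ty.proc), InStep m P P' →
      ∃ Q' : Tm ob Δ [ob s] Ty.proc, InStep m Q Q' ∧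
        ∀ A : Tm ob Δ [] (ob s), R (P'.inst A) (Q'.inst A)
  tau : ∀ {Δ} {P Q : Tm ob Δ [] Ty.proc}, R P Q →
    ∀ P' : Tm ob Δ [] Ty.proc, TauStep P P' →
      ∃ Q' : Tm ob Δ [] Ty.proc, TauStep Q Q' ∧ R P' Q'

/-- Strong HO bisimilarity on closed terms: the union of all strong HO bisimulations. -/
def HOBisimilarClosed {Δ : List S} {T : Ty S} (P Q : Tm ob Δ [] T) : Prop :=
  ∃ R : ∀ {Δ : List S} {T : Ty S}, Tm ob Δ [] T → Tm ob Δ [] T → Prop,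
    IsHOBisim R ∧ R P Q

/-- Strong HO bisimilarity on arbitrary terms: all closed instantiations of the free process
variables are strong HO bisimilar. -/
def HOBisimilar {Δ : List S} {Γ : List (Ty S)} {T : Ty S} (P Q : Tm ob Δ Γ T) : Prop :=
  ∀ σ : PSub ob Δ Γ [], HOBisimilarClosed (P.psub σ) (Q.psub σ)

end

end HOmp

/-!
Up to structural congruence, a process is a finite multiset of prime components: outputs, inputs,
variables and applied variables. The multiset is computed by head evaluation, which terminates for
well-typed terms by a logical relation argument, and it is an invariant of the congruence class. So
both bisimulation games are played on multisets of components, and cancellation of components is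
meaningful.

HO-IO bisimilarity implies HO bisimilarity because the former is closed under substitution: a move
of an instance of `P` comes either from a component of `P` or from the instance of a variable, and
bisimilar terms have the same variable components. A substituted abstraction may create new
redexes, so the induction is on sizes of normal forms, inside a logical relation on types.

Conversely, an open term is recovered from a single closed instance. The map `ob` being onto, there
is at every type a trigger: a closed term that, when run, outputs its own arguments at a fresh
constant. Bisimilar instances of `P` and `Q` under triggers have matching outputs, and an output at
the constant of a trigger can only come from a component of the term that is headed by the variable
it replaces. Which constants are fresh depends on the terms, and the answer to a move may depend on
the triggers, so one considers infinitely many substitutions of triggers at once: a term has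
finitely many answers up to congruence, and one of them is good for infinitely many substitutions.
-/

namespace HOmp

universe u

variable {S : Type u} {ob : S → Ty S} {Δ Δ' Δ'' : List S} {Γ Γ' Γ'' : List (Ty S)} {s : S}
  {T U : Ty S}

/-! ### The substitution calculus -/

/-- The identity name substitution. -/
def NSub.id : NSub Δ Δ := fun _ x => .var x

/-- Composition of name substitutions, in diagrammatic order. -/
def NSub.comp (ρ : NSub Δ Δ') (ρ' : NSub Δ' Δ'') : NSub Δ Δ'' := fun s x => (ρ s x).nsub ρ'

/-- Extension of a name substitution by an image for a new name variable. -/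
def NSub.cons (n : Nm Δ' s) (ρ : NSub Δ Δ') : NSub (s :: Δ) Δ'
  | _, .zero => n
  | _, .succ x => ρ _ x

theorem NSub.ext {ρ ρ' : NSub Δ Δ'} (h : ∀ s x, ρ s x = ρ' s x) : ρ = ρ' :=
  funext fun s => funext (h s)

theorem Nm.nsub_nsub (ρ : NSub Δ Δ') (ρ' : NSub Δ' Δ'') (n : Nm Δ s) :
    (n.nsub ρ).nsub ρ' = n.nsub (ρ.comp ρ') := by
  cases n <;> rfl

theorem Nm.nsub_id (n : Nm Δ s) : n.nsub .id = n := by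
  cases n <;> rfl

theorem NSub.id_comp (ρ : NSub Δ Δ') : NSub.id.comp ρ = ρ := rfl

theorem NSub.comp_id (ρ : NSub Δ Δ') : ρ.comp .id = ρ :=
  NSub.ext fun _ _ => Nm.nsub_id _

theorem NSub.lift_id (s : S) : (NSub.id : NSub Δ Δ).lift s = .id := by
  apply NSub.ext
  rintro _ (_ | x) <;> rfl

theorem NSub.lift_comp (ρ : NSub Δ Δ') (ρ' : NSub Δ' Δ'') (s : S) :
    (ρ.lift s).comp (ρ'.lift s) = (ρ.comp ρ').lift s := by
  apply NSub.ext
  rintro _ (_ | x)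
  · rfl
  · simp only [NSub.comp, NSub.lift, Nm.nsub_nsub]
    rfl

theorem NSub.wk_comp_lift (ρ : NSub Δ Δ') (s : S) :
    (NSub.wk s).comp (ρ.lift s) = ρ.comp (NSub.wk s) := rfl

theorem NSub.wk_comp_single (n : Nm Δ s) : (NSub.wk s).comp (NSub.single n) = .id := rfl

theorem NSub.lift_comp_single (ρ : NSub Δ Δ') (n : Nm Δ' s) :
    (ρ.lift s).comp (NSub.single n) = NSub.cons n ρ := by
  apply NSub.ext
  rintro _ (_ | x)
  · rfl
  · simp only [NSub.comp, NSub.lift, NSub.cons, Nm.nsub_nsub, NSub.wk_comp_single, Nm.nsub_id]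

theorem NSub.single_comp (n : Nm Δ s) (ρ : NSub Δ Δ') :
    (NSub.single n).comp ρ = NSub.cons (n.nsub ρ) ρ := by
  apply NSub.ext
  rintro _ (_ | x) <;> rfl

theorem NSub.cons_zero_wk (s : S) :
    NSub.cons (.var .zero) (NSub.wk s) = (.id : NSub (s :: Δ) _) := by
  apply NSub.ext
  rintro _ (_ | x) <;> rfl

theorem Tm.nsub_nsub (ρ : NSub Δ Δ') (ρ' : NSub Δ' Δ'') (P : Tm ob Δ Γ T) :
    (P.nsub ρ).nsub ρ' = P.nsub (ρ.comp ρ') := by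
  induction P generalizing Δ' Δ'' <;> simp_all [Tm.nsub, Nm.nsub_nsub, NSub.lift_comp]

theorem Tm.nsub_id (P : Tm ob Δ Γ T) : P.nsub .id = P := by
  induction P <;> simp_all [Tm.nsub, Nm.nsub_id, NSub.lift_id]

/-- The identity process substitution. -/
def PSub.id : PSub ob Δ Γ Γ := fun _ X => .var X

/-- A renaming as a substitution. -/
def PSub.ofRen (r : Ren Γ Γ') : PSub ob Δ Γ Γ' := fun _ X => .var (r _ X)

/-- Extension of a process substitution by an image for a new process variable. -/
def PSub.cons (A : Tm ob Δ Γ' T) (σ : PSub ob Δ Γ Γ') : PSub ob Δ (T :: Γ) Γ'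
  | _, .zero => A
  | _, .succ X => σ _ X

theorem PSub.ext {σ σ' : PSub ob Δ Γ Γ'} (h : ∀ T X, σ T X = σ' T X) : σ = σ' :=
  funext fun T => funext (h T)

theorem PSub.lift_id (T : Ty S) : (PSub.id : PSub ob Δ Γ Γ).lift T = .id := by
  apply PSub.ext
  rintro _ (_ | X) <;> rfl

theorem PSub.lift_ofRen (r : Ren Γ Γ') (T : Ty S) :
    (PSub.ofRen r : PSub ob Δ Γ Γ').lift T = .ofRen (r.lift T) := by
  apply PSub.ext
  rintro _ (_ | X) <;> rfl

theorem PSub.cons_zero_wk (T : Ty S) :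
    PSub.cons (.var .zero) (.ofRen (Ren.wk T)) = (.id : PSub ob Δ (T :: Γ) _) := by
  apply PSub.ext
  rintro _ (_ | X) <;> rfl

theorem Tm.psub_id (P : Tm ob Δ Γ T) : P.psub .id = P := by
  induction P with
  | nabs P ih => exact congrArg Tm.nabs ih
  | var X => rfl
  | _ => simp_all [Tm.psub, PSub.lift_id]

theorem Tm.ren_eq_psub (r : Ren Γ Γ') (P : Tm ob Δ Γ T) : P.ren r = P.psub (.ofRen r) := by
  induction P generalizing Γ' <;> simp_all [Tm.ren, Tm.psub, PSub.lift_ofRen] <;> rfl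

theorem Tm.nsub_ren (r : Ren Γ Γ') (ρ : NSub Δ Δ') (P : Tm ob Δ Γ T) :
    (P.ren r).nsub ρ = (P.nsub ρ).ren r := by
  induction P generalizing Γ' Δ' <;> simp_all [Tm.ren, Tm.nsub]

theorem PSub.lift_precomp_ren (r : Ren Γ Γ') (σ : PSub ob Δ Γ' Γ'') (T : Ty S) :
    (fun U X => σ.lift T U (r.lift T U X)) = PSub.lift (fun U X => σ U (r U X)) T := by
  apply PSub.ext
  rintro _ (_ | X) <;> rfl

theorem Tm.psub_ren (r : Ren Γ Γ') (σ : PSub ob Δ Γ' Γ'') (P : Tm ob Δ Γ T) :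
    (P.ren r).psub σ = P.psub fun U X => σ U (r U X) := by
  induction P generalizing Γ' Γ'' with
  | nabs P ih =>
    simp only [Tm.ren, Tm.psub, ih]
    rfl
  | _ => simp_all [Tm.ren, Tm.psub, PSub.lift_precomp_ren]

theorem Tm.ren_ren (r : Ren Γ Γ') (r' : Ren Γ' Γ'') (P : Tm ob Δ Γ T) :
    (P.ren r).ren r' = P.ren fun U X => r' U (r U X) := by
  rw [Tm.ren_eq_psub r', Tm.psub_ren]
  exact (Tm.ren_eq_psub _ _).symm

theorem Tm.wk_ren_lift (r : Ren Γ Γ') (P : Tm ob Δ Γ T) :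
    (P.wk U).ren (r.lift U) = (P.ren r).wk U := by
  simp only [Tm.wk, Tm.ren_ren]
  rfl

theorem PSub.lift_postcomp_ren (σ : PSub ob Δ Γ Γ') (r : Ren Γ' Γ'') (T : Ty S) :
    (fun U X => (σ.lift T U X).ren (r.lift T)) = PSub.lift (fun U X => (σ U X).ren r) T := by
  apply PSub.ext
  rintro _ (_ | X)
  · rfl
  · exact Tm.wk_ren_lift _ _

theorem PSub.nlift_postcomp_ren (σ : PSub ob Δ Γ Γ') (r : Ren Γ' Γ'') (s : S) :
    (fun U X => (σ.nlift s U X).ren r) = PSub.nlift (fun U X => (σ U X).ren r) s :=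
  PSub.ext fun _ _ => (Tm.nsub_ren _ _ _).symm

theorem Tm.ren_psub (σ : PSub ob Δ Γ Γ') (r : Ren Γ' Γ'') (P : Tm ob Δ Γ T) :
    (P.psub σ).ren r = P.psub fun U X => (σ U X).ren r := by
  induction P generalizing Γ' Γ'' <;>
    simp_all [Tm.ren, Tm.psub, PSub.lift_postcomp_ren, PSub.nlift_postcomp_ren]

theorem PSub.lift_postcomp_nsub (σ : PSub ob Δ Γ Γ') (ρ : NSub Δ Δ') (T : Ty S) :
    (fun U X => (σ.lift T U X).nsub ρ) = PSub.lift (fun U X => (σ U X).nsub ρ) T := by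
  apply PSub.ext
  rintro _ (_ | X)
  · rfl
  · exact Tm.nsub_ren _ _ _

theorem PSub.nlift_postcomp_nsub (σ : PSub ob Δ Γ Γ') (ρ : NSub Δ Δ') (s : S) :
    (fun U X => (σ.nlift s U X).nsub (ρ.lift s)) = PSub.nlift (fun U X => (σ U X).nsub ρ) s := by
  apply PSub.ext
  intro U X
  simp only [PSub.nlift, Tm.nsub_nsub, NSub.wk_comp_lift]

theorem Tm.nsub_psub (σ : PSub ob Δ Γ Γ') (ρ : NSub Δ Δ') (P : Tm ob Δ Γ T) :
    (P.psub σ).nsub ρ = (P.nsub ρ).psub fun U X => (σ U X).nsub ρ := by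
  induction P generalizing Γ' Δ' <;>
    simp_all [Tm.nsub, Tm.psub, PSub.lift_postcomp_nsub, PSub.nlift_postcomp_nsub]

theorem PSub.lift_postcomp_psub (σ : PSub ob Δ Γ Γ') (σ' : PSub ob Δ Γ' Γ'') (T : Ty S) :
    (fun U X => (σ.lift T U X).psub (σ'.lift T)) =
      PSub.lift (fun U X => (σ U X).psub σ') T := by
  apply PSub.ext
  rintro _ (_ | X)
  · rfl
  · simp only [PSub.lift, Tm.wk, Tm.psub_ren, Tm.ren_psub]
    rfl

theorem PSub.nlift_postcomp_psub (σ : PSub ob Δ Γ Γ') (σ' : PSub ob Δ Γ' Γ'') (s : S) :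
    (fun U X => (σ.nlift s U X).psub (σ'.nlift s)) =
      PSub.nlift (fun U X => (σ U X).psub σ') s :=
  PSub.ext fun _ _ => (Tm.nsub_psub _ _ _).symm

theorem Tm.psub_psub (σ : PSub ob Δ Γ Γ') (σ' : PSub ob Δ Γ' Γ'') (P : Tm ob Δ Γ T) :
    (P.psub σ).psub σ' = P.psub fun U X => (σ U X).psub σ' := by
  induction P generalizing Γ' Γ'' <;>
    simp_all [Tm.psub, PSub.lift_postcomp_psub, PSub.nlift_postcomp_psub]

/-- Application of a name substitution followed by a process substitution. -/
def Tm.sub (ρ : NSub Δ Δ') (σ : PSub ob Δ' Γ Γ') (P : Tm ob Δ Γ T) : Tm ob Δ' Γ' T :=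
  (P.nsub ρ).psub σ

/-- Postcomposition of a process substitution with a name and a process substitution. -/
def PSub.andThen (σ : PSub ob Δ Γ Γ') (ρ : NSub Δ Δ') (σ' : PSub ob Δ' Γ' Γ'') :
    PSub ob Δ' Γ Γ'' :=
  fun _ X => (σ _ X).sub ρ σ'

theorem Tm.sub_sub (ρ : NSub Δ Δ') (σ : PSub ob Δ' Γ Γ') (ρ' : NSub Δ' Δ'')
    (σ' : PSub ob Δ'' Γ' Γ'') (P : Tm ob Δ Γ T) :
    (P.sub ρ σ).sub ρ' σ' = P.sub (ρ.comp ρ') (σ.andThen ρ' σ') := by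
  simp only [Tm.sub, Tm.nsub_psub, Tm.nsub_nsub]
  exact Tm.psub_psub _ _ _

theorem Tm.sub_id (P : Tm ob Δ Γ T) : P.sub .id .id = P := by
  rw [Tm.sub, Tm.nsub_id, Tm.psub_id]

theorem Tm.psub_eq_sub (σ : PSub ob Δ Γ Γ') (P : Tm ob Δ Γ T) : P.psub σ = P.sub .id σ := by
  rw [Tm.sub, Tm.nsub_id]

theorem Tm.nsub_eq_sub (ρ : NSub Δ Δ') (P : Tm ob Δ Γ T) : P.nsub ρ = P.sub ρ .id := by
  rw [Tm.sub, Tm.psub_id]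

theorem Tm.ren_eq_sub (r : Ren Γ Γ') (P : Tm ob Δ Γ T) : P.ren r = P.sub .id (.ofRen r) := by
  rw [Tm.ren_eq_psub, Tm.psub_eq_sub]

theorem Tm.inst_sub_lift (ρ : NSub Δ Δ') (σ : PSub ob Δ' Γ Γ') (P : Tm ob Δ (T :: Γ) U)
    (A : Tm ob Δ' Γ' T) : (P.sub ρ (σ.lift T)).inst A = P.sub ρ (.cons A σ) := by
  simp only [Tm.inst, Tm.sub, Tm.psub_psub]
  congr 1
  apply PSub.ext
  rintro _ (_ | X)
  · rfl
  · simp only [PSub.lift, Tm.wk, Tm.psub_ren, PSub.cons]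
    exact Tm.psub_id _

theorem Tm.sub_inst (ρ : NSub Δ Δ') (σ : PSub ob Δ' Γ Γ') (P : Tm ob Δ (T :: Γ) U)
    (A : Tm ob Δ Γ T) : (P.inst A).sub ρ σ = P.sub ρ (.cons (A.sub ρ σ) σ) := by
  simp only [Tm.inst, Tm.psub_eq_sub, Tm.sub_sub, NSub.id_comp]
  congr 1
  apply PSub.ext
  rintro _ (_ | X) <;> rfl

theorem Tm.ninst_sub_lift (ρ : NSub Δ Δ') (σ : PSub ob Δ' Γ Γ') (P : Tm ob (s :: Δ) Γ U)
    (n : Nm Δ' s) : (P.sub (ρ.lift s) (σ.nlift s)).ninst n = P.sub (.cons n ρ) σ := by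
  simp only [Tm.ninst, Tm.nsub_eq_sub, Tm.sub_sub, NSub.lift_comp_single]
  congr 1
  apply PSub.ext
  intro T X
  simp only [PSub.andThen, PSub.nlift, Tm.nsub_eq_sub, Tm.sub_sub, NSub.wk_comp_single]
  exact Tm.sub_id _

theorem Tm.sub_ninst (ρ : NSub Δ Δ') (σ : PSub ob Δ' Γ Γ') (P : Tm ob (s :: Δ) Γ U)
    (n : Nm Δ s) : (P.ninst n).sub ρ σ = P.sub (.cons (n.nsub ρ) ρ) σ := by
  simp only [Tm.ninst, Tm.nsub_eq_sub, Tm.sub_sub, NSub.single_comp]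
  rfl

theorem Tm.wk_sub_lift (ρ : NSub Δ Δ') (σ : PSub ob Δ' Γ Γ') (P : Tm ob Δ Γ U) :
    (P.wk T).sub ρ (σ.lift T) = (P.sub ρ σ).wk T := by
  simp only [Tm.wk, Tm.ren_eq_sub, Tm.sub_sub, NSub.id_comp, NSub.comp_id]
  congr 1
  exact PSub.ext fun _ _ => Tm.ren_eq_sub _ _

theorem Tm.wk_inst (P : Tm ob Δ Γ U) (A : Tm ob Δ Γ T) : (P.wk T).inst A = P := by
  simp only [Tm.wk, Tm.inst, Tm.psub_ren]
  exact Tm.psub_id _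

/-! ### Structural congruence under substitutions and on bodies -/

theorem SC.par_nil_left (P : Tm ob Δ Γ Ty.proc) : SC (.par .nil P) P :=
  (SC.par_comm _ _).trans (SC.par_nil P)

theorem SC.sub {P Q : Tm ob Δ Γ T} (h : SC P Q) (ρ : NSub Δ Δ') (σ : PSub ob Δ' Γ Γ') :
    SC (P.sub ρ σ) (Q.sub ρ σ) := by
  induction h generalizing Δ' Γ' with
  | refl => exact .refl _
  | symm _ ih => exact (ih ρ σ).symm
  | trans _ _ ihPQ ihQR => exact (ihPQ ρ σ).trans (ihQR ρ σ)
  | inp _ _ ih => exact .inp _ (ih ρ (σ.lift _))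
  | out _ _ ih => exact .out _ (ih ρ σ)
  | par _ _ ihP ihQ => exact .par (ihP ρ σ) (ihQ ρ σ)
  | pabs _ ih => exact .pabs (ih ρ (σ.lift _))
  | papp _ _ ihP ihQ => exact .papp (ihP ρ σ) (ihQ ρ σ)
  | nabs _ ih => exact .nabs (ih (ρ.lift _) (σ.nlift _))
  | napp _ _ ih => exact .napp _ (ih ρ σ)
  | par_assoc => exact .par_assoc _ _ _
  | par_comm => exact .par_comm _ _
  | par_nil => exact .par_nil _
  | pbeta P Q =>
    rw [Tm.sub_inst, ← Tm.inst_sub_lift]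
    exact .pbeta _ _
  | nbeta P n =>
    rw [Tm.sub_ninst, ← Tm.ninst_sub_lift]
    exact .nbeta _ _

theorem SC.psub {P Q : Tm ob Δ Γ T} (h : SC P Q) (σ : PSub ob Δ Γ Γ') :
    SC (P.psub σ) (Q.psub σ) := by
  rw [Tm.psub_eq_sub, Tm.psub_eq_sub]
  exact h.sub _ _

theorem SC.nsub {P Q : Tm ob Δ Γ T} (h : SC P Q) (ρ : NSub Δ Δ') :
    SC (P.nsub ρ) (Q.nsub ρ) := by
  rw [Tm.nsub_eq_sub, Tm.nsub_eq_sub]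
  exact h.sub _ _

theorem SC.wk {P Q : Tm ob Δ Γ T} (h : SC P Q) : SC (P.wk U) (Q.wk U) := by
  rw [Tm.wk, Tm.wk, Tm.ren_eq_sub, Tm.ren_eq_sub]
  exact h.sub _ _

theorem SC.inst {P Q : Tm ob Δ (T :: Γ) U} (h : SC P Q) (A : Tm ob Δ Γ T) :
    SC (P.inst A) (Q.inst A) :=
  h.psub _

theorem SC.papp_sub_pbody (ρ : NSub Δ Δ') (σ : PSub ob Δ' Γ Γ') (P : Tm ob Δ Γ (.pabs T))
    (A : Tm ob Δ' Γ' T) : SC (.papp (P.sub ρ σ) A) (P.pbody.sub ρ (.cons A σ)) := by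
  cases P with
  | pabs C =>
    rw [Tm.pbody, ← Tm.inst_sub_lift]
    exact .pbeta _ _
  | var X => exact .refl _

theorem SC.napp_sub_nbody (ρ : NSub Δ Δ') (σ : PSub ob Δ' Γ Γ') (P : Tm ob Δ Γ (.nabs s))
    (n : Nm Δ' s) : SC (.napp (P.sub ρ σ) n) (P.nbody.sub (.cons n ρ) σ) := by
  cases P with
  | nabs C =>
    rw [Tm.nbody, ← Tm.ninst_sub_lift]
    exact .nbeta _ _
  | var X => exact .refl _

theorem SC.papp_wk_zero (P : Tm ob Δ Γ (.pabs T)) :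
    SC (.papp (P.wk T) (.var .zero)) P.pbody := by
  have h := SC.papp_sub_pbody .id (.ofRen (Ren.wk T)) P (.var .zero)
  rwa [PSub.cons_zero_wk, Tm.sub_id, ← Tm.ren_eq_sub] at h

theorem SC.napp_wk_zero (P : Tm ob Δ Γ (.nabs s)) :
    SC (.napp (P.nsub (NSub.wk s)) (.var .zero)) P.nbody := by
  have h := SC.napp_sub_nbody (NSub.wk s) .id P (.var .zero)
  rwa [NSub.cons_zero_wk, Tm.sub_id, ← Tm.nsub_eq_sub] at h

theorem SC.sub_pbody (ρ : NSub Δ Δ') (σ : PSub ob Δ' Γ Γ') (P : Tm ob Δ Γ (.pabs T)) :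
    SC (P.sub ρ σ).pbody (P.pbody.sub ρ (σ.lift T)) := by
  cases P with
  | pabs C => exact .refl _
  | var X => exact (SC.papp_wk_zero _).symm

theorem SC.sub_nbody (ρ : NSub Δ Δ') (σ : PSub ob Δ' Γ Γ') (P : Tm ob Δ Γ (.nabs s)) :
    SC (P.sub ρ σ).nbody (P.nbody.sub (ρ.lift s) (σ.nlift s)) := by
  cases P with
  | nabs C => exact .refl _
  | var X => exact (SC.napp_wk_zero _).symm

theorem SC.pbody {P Q : Tm ob Δ Γ (.pabs T)} (h : SC P Q) : SC P.pbody Q.pbody :=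
  (SC.papp_wk_zero P).symm.trans ((SC.papp h.wk (.refl _)).trans (SC.papp_wk_zero Q))

theorem SC.nbody {P Q : Tm ob Δ Γ (.nabs s)} (h : SC P Q) : SC P.nbody Q.nbody :=
  (SC.napp_wk_zero P).symm.trans ((SC.napp _ (h.nsub _)).trans (SC.napp_wk_zero Q))

/-! ### Prime components and evaluation -/

instance scSetoid (ob : S → Ty S) (Δ : List S) (Γ : List (Ty S)) (T : Ty S) :
    Setoid (Tm ob Δ Γ T) :=
  ⟨SC, .refl, .symm, .trans⟩

/-- Terms up to structural congruence. -/
abbrev Cls (ob : S → Ty S) (Δ : List S) (Γ : List (Ty S)) (T : Ty S) : Type u :=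
  Quotient (scSetoid ob Δ Γ T)

/-- The structural congruence class of a term. -/
def Tm.cls (P : Tm ob Δ Γ T) : Cls ob Δ Γ T := Quotient.mk _ P

theorem Tm.cls_eq_cls {P Q : Tm ob Δ Γ T} : P.cls = Q.cls ↔ SC P Q := Quotient.eq

theorem Cls.exists_cls_eq (a : Cls ob Δ Γ T) : ∃ A : Tm ob Δ Γ T, A.cls = a :=
  Quotient.exists_rep a

/-- The prime components of a process: outputs, inputs, variables and applied variables, with
subterms taken up to structural congruence. -/
inductive Component (ob : S → Ty S) (Δ : List S) (Γ : List (Ty S)) : Type u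
  | out {s : S} (m : Nm Δ s) (a : Cls ob Δ Γ (ob s)) : Component ob Δ Γ
  | inp {s : S} (m : Nm Δ s) (p : Cls ob Δ (ob s :: Γ) Ty.proc) : Component ob Δ Γ
  | var (X : Var Γ Ty.proc) : Component ob Δ Γ
  | papp {T : Ty S} (X : Var Γ (Ty.pabs T)) (a : Cls ob Δ Γ T) : Component ob Δ Γ
  | napp {s : S} (X : Var Γ (Ty.nabs s)) (d : Nm Δ s) : Component ob Δ Γ

/-- Evaluation of a process to the multiset of its prime components, by head reduction. -/
inductive Evals : {T : Ty S} → Tm ob Δ Γ T → Multiset (Component ob Δ Γ) → Prop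
  | nil : Evals .nil 0
  | par {P Q : Tm ob Δ Γ Ty.proc} {a b : Multiset (Component ob Δ Γ)} :
      Evals P a → Evals Q b → Evals (.par P Q) (a + b)
  | out {s : S} (m : Nm Δ s) (A : Tm ob Δ Γ (ob s)) : Evals (.out m A) {.out m A.cls}
  | inp {s : S} (m : Nm Δ s) (P : Tm ob Δ (ob s :: Γ) Ty.proc) :
      Evals (.inp m P) {.inp m P.cls}
  | var (X : Var Γ Ty.proc) : Evals (.var X) {.var X}
  | papp {T : Ty S} (X : Var Γ (Ty.pabs T)) (A : Tm ob Δ Γ T) :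
      Evals (.papp (.var X) A) {.papp X A.cls}
  | napp {s : S} (X : Var Γ (Ty.nabs s)) (d : Nm Δ s) : Evals (.napp (.var X) d) {.napp X d}
  | pbeta {T : Ty S} {P : Tm ob Δ (T :: Γ) Ty.proc} {A : Tm ob Δ Γ T}
      {a : Multiset (Component ob Δ Γ)} : Evals (P.inst A) a → Evals (.papp (.pabs P) A) a
  | nbeta {s : S} {P : Tm ob (s :: Δ) Γ Ty.proc} {n : Nm Δ s}
      {a : Multiset (Component ob Δ Γ)} : Evals (P.ninst n) a → Evals (.napp (.nabs P) n) a

theorem Evals.unique {P : Tm ob Δ Γ T} {a b : Multiset (Component ob Δ Γ)} (ha : Evals P a)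
    (hb : Evals P b) : a = b := by
  induction ha generalizing b with
  | par _ _ ihP ihQ =>
    cases hb with
    | par hP hQ => rw [ihP hP, ihQ hQ]
  | pbeta _ ih =>
    cases hb with
    | pbeta h => exact ih h
  | nbeta _ ih =>
    cases hb with
    | nbeta h => exact ih h
  | _ =>
    cases hb
    rfl

/-- `HasSize P n`: the eta-long normal form of `P` has size `n`. This is a relation closed under
structural congruence, so that no normal form has to be constructed. -/
inductive HasSize : {Δ : List S} → {Γ : List (Ty S)} → {T : Ty S} → Tm ob Δ Γ T → ℕ → Prop
  | congr {Δ : List S} {Γ : List (Ty S)} {T : Ty S} {P Q : Tm ob Δ Γ T} {n : ℕ} :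
      SC P Q → HasSize P n → HasSize Q n
  | nil {Δ : List S} {Γ : List (Ty S)} : HasSize (.nil : Tm ob Δ Γ Ty.proc) 0
  | par {Δ : List S} {Γ : List (Ty S)} {P Q : Tm ob Δ Γ Ty.proc} {k n : ℕ} :
      HasSize P k → HasSize Q n → HasSize (.par P Q) (k + n)
  | inp {Δ : List S} {Γ : List (Ty S)} {s : S} (m : Nm Δ s) {P : Tm ob Δ (ob s :: Γ) Ty.proc}
      {n : ℕ} : HasSize P n → HasSize (.inp m P) (n + 1)
  | out {Δ : List S} {Γ : List (Ty S)} {s : S} (m : Nm Δ s) {A : Tm ob Δ Γ (ob s)} {n : ℕ} :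
      HasSize A n → HasSize (.out m A) (n + 1)
  | var {Δ : List S} {Γ : List (Ty S)} (X : Var Γ Ty.proc) :
      HasSize (.var X : Tm ob Δ Γ Ty.proc) 1
  | papp {Δ : List S} {Γ : List (Ty S)} {T : Ty S} (X : Var Γ (Ty.pabs T)) {A : Tm ob Δ Γ T}
      {n : ℕ} : HasSize A n → HasSize (.papp (.var X) A) (n + 1)
  | napp {Δ : List S} {Γ : List (Ty S)} {s : S} (X : Var Γ (Ty.nabs s)) (d : Nm Δ s) :
      HasSize (.napp (.var X) d : Tm ob Δ Γ Ty.proc) 1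
  | pabs {Δ : List S} {Γ : List (Ty S)} {T : Ty S} {P : Tm ob Δ Γ (Ty.pabs T)} {n : ℕ} :
      HasSize P.pbody n → HasSize P (n + 1)
  | nabs {Δ : List S} {Γ : List (Ty S)} {s : S} {P : Tm ob Δ Γ (Ty.nabs s)} {n : ℕ} :
      HasSize P.nbody n → HasSize P (n + 1)

theorem HasSize.exists_var (X : Var Γ T) : ∃ n, HasSize (.var X : Tm ob Δ Γ T) n := by
  induction T generalizing Γ with
  | proc => exact ⟨1, .var X⟩
  | pabs T ih =>
    obtain ⟨n, hn⟩ := ih (Γ := T :: Γ) .zero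
    exact ⟨_, .pabs (.papp X.succ hn)⟩
  | nabs s => exact ⟨_, .nabs (.napp X _)⟩

/-! ### Kripke logical relations -/

/-- Type-indexed relations on open terms. -/
abbrev TermRel (ob : S → Ty S) : Type u :=
  ∀ ⦃Δ : List S⦄ ⦃Γ : List (Ty S)⦄ ⦃T : Ty S⦄, Tm ob Δ Γ T → Tm ob Δ Γ T → Prop

/-- The condition that the Kripke logical relation `LogRel B` imposes on applications in the
current scope: those of process-abstractions to logically related arguments, and those of
name-abstractions to names, are related by `B`. -/
def AppRel (B : TermRel ob) : {T : Ty S} → {Δ : List S} → {Γ : List (Ty S)} →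
    Tm ob Δ Γ T → Tm ob Δ Γ T → Prop
  | .proc, _, _, _, _ => True
  | .pabs T, Δ, Γ, P, Q => ∀ A A' : Tm ob Δ Γ T,
      (∀ ⦃Δ' : List S⦄ ⦃Γ' : List (Ty S)⦄ (ρ : NSub Δ Δ') (r : Ren Γ Γ'),
        B (A.sub ρ (.ofRen r)) (A'.sub ρ (.ofRen r)) ∧
          AppRel B (A.sub ρ (.ofRen r)) (A'.sub ρ (.ofRen r))) →
      B (.papp P A) (.papp Q A')
  | .nabs s, Δ, _, P, Q => ∀ n : Nm Δ s, B (.napp P n) (.napp Q n)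

/-- The Kripke logical relation over a base relation `B`, whose worlds are the scopes. -/
def LogRel (B : TermRel ob) (P Q : Tm ob Δ Γ T) : Prop :=
  ∀ ⦃Δ' : List S⦄ ⦃Γ' : List (Ty S)⦄ (ρ : NSub Δ Δ') (r : Ren Γ Γ'),
    B (P.sub ρ (.ofRen r)) (Q.sub ρ (.ofRen r)) ∧
      AppRel B (P.sub ρ (.ofRen r)) (Q.sub ρ (.ofRen r))

/-- Symmetry of a relation at every type. -/
def TermRel.Symmetric (R : TermRel ob) : Prop :=
  ∀ ⦃Δ : List S⦄ ⦃Γ : List (Ty S)⦄ ⦃T : Ty S⦄ ⦃P Q : Tm ob Δ Γ T⦄, R P Q → R Q P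

/-- Transitivity of a relation at every type. -/
def TermRel.Transitive (R : TermRel ob) : Prop :=
  ∀ ⦃Δ : List S⦄ ⦃Γ : List (Ty S)⦄ ⦃T : Ty S⦄ ⦃P Q R' : Tm ob Δ Γ T⦄, R P Q → R Q R' → R P R'

section LogRel

variable {B : TermRel ob} {σ σ' : PSub ob Δ Γ Γ'}

theorem LogRel.mono {P Q : Tm ob Δ Γ T} (h : LogRel B P Q) (ρ : NSub Δ Δ') (r : Ren Γ Γ') :
    LogRel B (P.sub ρ (.ofRen r)) (Q.sub ρ (.ofRen r)) := by
  intro Δ'' Γ'' ρ' r'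
  simp only [Tm.sub_sub]
  exact h (ρ.comp ρ') fun _ X => r' _ (r _ X)

theorem LogRel.base_and_appRel {P Q : Tm ob Δ Γ T} (h : LogRel B P Q) :
    B P Q ∧ AppRel B P Q := by
  have h_id := h .id fun _ X => X
  have sub_id (R : Tm ob Δ Γ T) : R.sub .id (.ofRen fun _ X => X) = R := Tm.sub_id R
  rwa [sub_id, sub_id] at h_id

theorem LogRel.base {P Q : Tm ob Δ Γ T} (h : LogRel B P Q) : B P Q := h.base_and_appRel.1

theorem LogRel.papp {P Q : Tm ob Δ Γ (.pabs T)} {A A' : Tm ob Δ Γ T} (h : LogRel B P Q)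
    (hA : LogRel B A A') : B (.papp P A) (.papp Q A') :=
  h.base_and_appRel.2 A A' hA

theorem LogRel.napp {P Q : Tm ob Δ Γ (.nabs s)} (h : LogRel B P Q) (n : Nm Δ s) :
    B (.napp P n) (.napp Q n) :=
  h.base_and_appRel.2 n

theorem AppRel.symm (hB : B.Symmetric) {P Q : Tm ob Δ Γ T}
    (h : AppRel B P Q) : AppRel B Q P := by
  induction T generalizing Δ Γ with
  | proc => trivial
  | pabs T ih => exact fun A A' hA => hB (h A' A fun _ _ ρ r => ⟨hB (hA ρ r).1, ih (hA ρ r).2⟩)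
  | nabs s => exact fun n => hB (h n)

theorem LogRel.symm (hB : B.Symmetric) {P Q : Tm ob Δ Γ T}
    (h : LogRel B P Q) : LogRel B Q P :=
  fun _ _ ρ r => ⟨hB (h ρ r).1, (h ρ r).2.symm hB⟩

theorem AppRel.trans (hsymm : B.Symmetric) (htrans : B.Transitive) {P Q R : Tm ob Δ Γ T}
    (hPQ : AppRel B P Q) (hQR : AppRel B Q R) : AppRel B P R := by
  induction T generalizing Δ Γ with
  | proc => trivial
  | pabs T ih =>
    exact fun A A' hA => htrans (hPQ A A' hA) (hQR A' A' fun _ _ ρ r =>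
      ⟨htrans (hsymm (hA ρ r).1) (hA ρ r).1, ih ((hA ρ r).2.symm hsymm) (hA ρ r).2⟩)
  | nabs s => exact fun n => htrans (hPQ n) (hQR n)

theorem LogRel.trans (hsymm : B.Symmetric) (htrans : B.Transitive) {P Q R : Tm ob Δ Γ T}
    (hPQ : LogRel B P Q) (hQR : LogRel B Q R) : LogRel B P R :=
  fun _ _ ρ r => ⟨htrans (hPQ ρ r).1 (hQR ρ r).1, (hPQ ρ r).2.trans hsymm htrans (hQR ρ r).2⟩

/-- Logically related substitutions. -/
def PSub.Rel (B : TermRel ob) (σ σ' : PSub ob Δ Γ Γ') : Prop :=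
  ∀ T X, LogRel B (σ T X) (σ' T X)

theorem PSub.Rel.mono (h : PSub.Rel B σ σ') (ρ : NSub Δ Δ') (r : Ren Γ' Γ'') :
    PSub.Rel B (σ.andThen ρ (.ofRen r)) (σ'.andThen ρ (.ofRen r)) :=
  fun T X => (h T X).mono ρ r

theorem PSub.Rel.cons {A A' : Tm ob Δ Γ' T} (hA : LogRel B A A') (h : PSub.Rel B σ σ') :
    PSub.Rel B (.cons A σ) (.cons A' σ') := by
  rintro _ (_ | X)
  · exact hA
  · exact h _ X

theorem PSub.Rel.lift
    (hvar : ∀ ⦃Δ : List S⦄ ⦃Γ : List (Ty S)⦄ ⦃T : Ty S⦄ (X : Var Γ T),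
      LogRel B (.var X : Tm ob Δ Γ T) (.var X))
    (h : PSub.Rel B σ σ') (T : Ty S) : PSub.Rel B (σ.lift T) (σ'.lift T) := by
  rintro _ (_ | X)
  · exact hvar _
  · simp only [PSub.lift, Tm.wk, Tm.ren_eq_sub]
    exact (h _ X).mono _ _

theorem PSub.Rel.nlift (h : PSub.Rel B σ σ') (s : S) :
    PSub.Rel B (σ.nlift s) (σ'.nlift s) := by
  intro T X
  simp only [PSub.nlift, Tm.nsub_eq_sub]
  exact (h _ X).mono (NSub.wk s) fun _ X => X

/-- Terms whose instances under logically related substitutions are logically related. -/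
def OpenLogRel (B : TermRel ob) (P Q : Tm ob Δ Γ T) : Prop :=
  ∀ ⦃Δ' : List S⦄ ⦃Γ' : List (Ty S)⦄ (ρ : NSub Δ Δ') (σ σ' : PSub ob Δ' Γ Γ'),
    PSub.Rel B σ σ' → LogRel B (P.sub ρ σ) (Q.sub ρ σ')

theorem OpenLogRel.of_forall {P Q : Tm ob Δ Γ T}
    (h : ∀ ⦃Δ' : List S⦄ ⦃Γ' : List (Ty S)⦄ (ρ : NSub Δ Δ') (σ σ' : PSub ob Δ' Γ Γ'),
      PSub.Rel B σ σ' →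
        B (P.sub ρ σ) (Q.sub ρ σ') ∧ AppRel B (P.sub ρ σ) (Q.sub ρ σ')) :
    OpenLogRel B P Q := by
  intro Δ' Γ' ρ σ σ' hσ Δ'' Γ'' ρ' r
  simp only [Tm.sub_sub]
  exact h _ _ _ (hσ.mono ρ' r)

theorem OpenLogRel.symm (hB : B.Symmetric) {P Q : Tm ob Δ Γ T} (h : OpenLogRel B P Q) :
    OpenLogRel B Q P :=
  fun _ _ ρ _ _ hσ => (h ρ _ _ fun T X => (hσ T X).symm hB).symm hB

theorem OpenLogRel.trans (hsymm : B.Symmetric) (htrans : B.Transitive) {P Q R : Tm ob Δ Γ T}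
    (hPQ : OpenLogRel B P Q) (hQR : OpenLogRel B Q R) : OpenLogRel B P R :=
  fun _ _ ρ _ _ hσ =>
    (hPQ ρ _ _ fun T X => (hσ T X).trans hsymm htrans ((hσ T X).symm hsymm)).trans hsymm htrans
      (hQR ρ _ _ hσ)

end LogRel

/-! ### Normalization -/

/-- Structural congruence between terms that have a size and, in the case of processes, evaluate
to the same multiset of prime components. As the base of a logical relation it contains all of
structural congruence, whence normalization. -/
structure NormSC ⦃Δ : List S⦄ ⦃Γ : List (Ty S)⦄ ⦃T : Ty S⦄ (P Q : Tm ob Δ Γ T) : Prop where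
  sc : SC P Q
  exists_hasSize : ∃ n, HasSize P n
  exists_evals : T = Ty.proc → ∃ a, Evals P a ∧ Evals Q a

namespace NormSC

theorem symm ⦃Δ : List S⦄ ⦃Γ : List (Ty S)⦄ ⦃T : Ty S⦄ ⦃P Q : Tm ob Δ Γ T⦄ (h : NormSC P Q) :
    NormSC Q P where
  sc := h.sc.symm
  exists_hasSize := h.exists_hasSize.imp fun _ hn => .congr h.sc hn
  exists_evals hT := (h.exists_evals hT).imp fun _ ha => ha.symm

theorem trans ⦃Δ : List S⦄ ⦃Γ : List (Ty S)⦄ ⦃T : Ty S⦄ ⦃P Q R : Tm ob Δ Γ T⦄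
    (hPQ : NormSC P Q) (hQR : NormSC Q R) : NormSC P R where
  sc := hPQ.sc.trans hQR.sc
  exists_hasSize := hPQ.exists_hasSize
  exists_evals hT := by
    obtain ⟨a, hPa, hQa⟩ := hPQ.exists_evals hT
    obtain ⟨b, hQb, hRb⟩ := hQR.exists_evals hT
    exact ⟨a, hPa, hQa.unique hQb ▸ hRb⟩

theorem pbeta_left {P : Tm ob Δ (T :: Γ) Ty.proc} {A : Tm ob Δ Γ T} {Q : Tm ob Δ Γ Ty.proc}
    (h : NormSC (P.inst A) Q) : NormSC (.papp (.pabs P) A) Q where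
  sc := (SC.pbeta P A).trans h.sc
  exists_hasSize := h.exists_hasSize.imp fun _ hn => .congr (SC.pbeta P A).symm hn
  exists_evals hT := (h.exists_evals hT).imp fun _ ha => ⟨.pbeta ha.1, ha.2⟩

theorem nbeta_left {P : Tm ob (s :: Δ) Γ Ty.proc} {n : Nm Δ s} {Q : Tm ob Δ Γ Ty.proc}
    (h : NormSC (P.ninst n) Q) : NormSC (.napp (.nabs P) n) Q where
  sc := (SC.nbeta P n).trans h.sc
  exists_hasSize := h.exists_hasSize.imp fun _ hk => .congr (SC.nbeta P n).symm hk
  exists_evals hT := (h.exists_evals hT).imp fun _ ha => ⟨.nbeta ha.1, ha.2⟩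

theorem logRel_var ⦃Δ : List S⦄ ⦃Γ : List (Ty S)⦄ ⦃T : Ty S⦄ (X : Var Γ T) :
    LogRel NormSC (.var X : Tm ob Δ Γ T) (.var X) := by
  intro Δ' Γ' ρ r
  cases T with
  | proc => exact ⟨⟨.refl _, HasSize.exists_var _, fun _ => ⟨_, .var _, .var _⟩⟩, trivial⟩
  | pabs T =>
    refine ⟨⟨.refl _, HasSize.exists_var _, nofun⟩, fun A A' hA => ?_⟩
    obtain ⟨hsc, ⟨n, hn⟩, -⟩ := LogRel.base hA
    refine ⟨.papp (.refl _) hsc, ⟨_, .papp _ hn⟩, fun _ => ⟨_, .papp _ _, ?_⟩⟩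
    rw [Tm.cls_eq_cls.2 hsc]
    exact .papp _ _
  | nabs s =>
    exact ⟨⟨.refl _, HasSize.exists_var _, nofun⟩, fun n =>
      ⟨.refl _, ⟨_, .napp _ _⟩, fun _ => ⟨_, .napp _ _, .napp _ _⟩⟩⟩

theorem openLogRel_nil : OpenLogRel NormSC (.nil : Tm ob Δ Γ Ty.proc) .nil :=
  .of_forall fun _ _ _ _ _ _ => ⟨⟨.refl _, ⟨_, .nil⟩, fun _ => ⟨_, .nil, .nil⟩⟩, trivial⟩

theorem openLogRel_inp (m : Nm Δ s) {P P' : Tm ob Δ (ob s :: Γ) Ty.proc}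
    (h : OpenLogRel NormSC P P') : OpenLogRel NormSC (.inp m P) (.inp m P') := by
  refine .of_forall fun Δ' Γ' ρ σ σ' hσ => ⟨?_, trivial⟩
  obtain ⟨hsc, ⟨n, hn⟩, -⟩ := (h ρ _ _ (hσ.lift logRel_var (ob s))).base
  refine ⟨.inp _ hsc, ⟨_, .inp _ hn⟩, fun _ => ⟨_, .inp _ _, ?_⟩⟩
  change Evals _ {.inp _ (P.sub ρ (σ.lift (ob s))).cls}
  rw [Tm.cls_eq_cls.2 hsc]
  exact .inp _ _

theorem openLogRel_out (m : Nm Δ s) {A A' : Tm ob Δ Γ (ob s)} (h : OpenLogRel NormSC A A') :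
    OpenLogRel NormSC (.out m A) (.out m A') := by
  refine .of_forall fun Δ' Γ' ρ σ σ' hσ => ⟨?_, trivial⟩
  obtain ⟨hsc, ⟨n, hn⟩, -⟩ := (h ρ _ _ hσ).base
  refine ⟨.out _ hsc, ⟨_, .out _ hn⟩, fun _ => ⟨_, .out _ _, ?_⟩⟩
  change Evals _ {.out _ (A.sub ρ σ).cls}
  rw [Tm.cls_eq_cls.2 hsc]
  exact .out _ _

theorem openLogRel_par {P P' Q Q' : Tm ob Δ Γ Ty.proc} (hP : OpenLogRel NormSC P P')
    (hQ : OpenLogRel NormSC Q Q') : OpenLogRel NormSC (.par P Q) (.par P' Q') := by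
  refine .of_forall fun Δ' Γ' ρ σ σ' hσ => ⟨?_, trivial⟩
  obtain ⟨hscP, ⟨k, hk⟩, hevP⟩ := (hP ρ _ _ hσ).base
  obtain ⟨hscQ, ⟨n, hn⟩, hevQ⟩ := (hQ ρ _ _ hσ).base
  obtain ⟨a, ha, ha'⟩ := hevP rfl
  obtain ⟨b, hb, hb'⟩ := hevQ rfl
  exact ⟨.par hscP hscQ, ⟨_, .par hk hn⟩, fun _ => ⟨_, .par ha hb, .par ha' hb'⟩⟩

theorem openLogRel_pabs {P P' : Tm ob Δ (T :: Γ) Ty.proc} (h : OpenLogRel NormSC P P') :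
    OpenLogRel NormSC (.pabs P) (.pabs P') := by
  refine .of_forall fun Δ' Γ' ρ σ σ' hσ => ?_
  obtain ⟨hsc, ⟨n, hn⟩, -⟩ := (h ρ _ _ (hσ.lift logRel_var T)).base
  refine ⟨⟨.pabs hsc, ⟨_, .pabs hn⟩, nofun⟩, fun A A' hA => ?_⟩
  refine pbeta_left (symm (pbeta_left (symm ?_)))
  change NormSC ((P.sub ρ (σ.lift T)).inst A) ((P'.sub ρ (σ'.lift T)).inst A')
  rw [Tm.inst_sub_lift, Tm.inst_sub_lift]
  exact (h ρ _ _ (hσ.cons hA)).base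

theorem openLogRel_papp {P P' : Tm ob Δ Γ (.pabs T)} {A A' : Tm ob Δ Γ T}
    (hP : OpenLogRel NormSC P P') (hA : OpenLogRel NormSC A A') :
    OpenLogRel NormSC (.papp P A) (.papp P' A') :=
  .of_forall fun _ _ ρ _ _ hσ => ⟨(hP ρ _ _ hσ).papp (hA ρ _ _ hσ), trivial⟩

theorem openLogRel_nabs {P P' : Tm ob (s :: Δ) Γ Ty.proc} (h : OpenLogRel NormSC P P') :
    OpenLogRel NormSC (.nabs P) (.nabs P') := by
  refine .of_forall fun Δ' Γ' ρ σ σ' hσ => ?_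
  obtain ⟨hsc, ⟨n, hn⟩, -⟩ := (h (ρ.lift s) _ _ (hσ.nlift s)).base
  refine ⟨⟨.nabs hsc, ⟨_, .nabs hn⟩, nofun⟩, fun n => ?_⟩
  refine nbeta_left (symm (nbeta_left (symm ?_)))
  change NormSC ((P.sub (ρ.lift s) (σ.nlift s)).ninst n)
    ((P'.sub (ρ.lift s) (σ'.nlift s)).ninst n)
  rw [Tm.ninst_sub_lift, Tm.ninst_sub_lift]
  exact (h _ _ _ hσ).base

theorem openLogRel_napp {P P' : Tm ob Δ Γ (.nabs s)} (n : Nm Δ s)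
    (h : OpenLogRel NormSC P P') : OpenLogRel NormSC (.napp P n) (.napp P' n) :=
  .of_forall fun _ _ ρ _ _ hσ => ⟨(h ρ _ _ hσ).napp _, trivial⟩

theorem openLogRel_refl (P : Tm ob Δ Γ T) : OpenLogRel NormSC P P := by
  induction P with
  | nil => exact openLogRel_nil
  | var X => exact fun _ _ _ _ _ hσ => hσ _ X
  | inp m _ ih => exact openLogRel_inp m ih
  | out m _ ih => exact openLogRel_out m ih
  | par _ _ ihP ihQ => exact openLogRel_par ihP ihQ
  | pabs _ ih => exact openLogRel_pabs ih
  | papp _ _ ihP ihA => exact openLogRel_papp ihP ihA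
  | nabs _ ih => exact openLogRel_nabs ih
  | napp _ n ih => exact openLogRel_napp n ih

theorem openLogRel_of_evals {P Q : Tm ob Δ Γ Ty.proc} (hsc : SC P Q)
    (hev : ∀ ⦃Δ' : List S⦄ ⦃Γ' : List (Ty S)⦄ (ρ : NSub Δ Δ') (σ : PSub ob Δ' Γ Γ')
      (a : Multiset (Component ob Δ' Γ')), Evals (P.sub ρ σ) a → Evals (Q.sub ρ σ) a) :
    OpenLogRel NormSC P Q := by
  refine .of_forall fun Δ' Γ' ρ σ σ' hσ => ⟨?_, trivial⟩
  have hP : NormSC (P.sub ρ σ) (P.sub ρ σ') := (openLogRel_refl P ρ _ _ hσ).base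
  refine hP.trans ⟨hsc.sub ρ σ', hP.symm.exists_hasSize, fun hT => ?_⟩
  obtain ⟨a, -, ha⟩ := hP.exists_evals hT
  exact ⟨a, ha, hev ρ σ' a ha⟩

theorem openLogRel_of_sc {P Q : Tm ob Δ Γ T} (h : SC P Q) : OpenLogRel NormSC P Q := by
  induction h with
  | refl P => exact openLogRel_refl P
  | symm _ ih => exact ih.symm symm
  | trans _ _ ihPQ ihQR => exact ihPQ.trans symm trans ihQR
  | inp m _ ih => exact openLogRel_inp m ih
  | out m _ ih => exact openLogRel_out m ih
  | par _ _ ihP ihQ => exact openLogRel_par ihP ihQ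
  | pabs _ ih => exact openLogRel_pabs ih
  | papp _ _ ihP ihA => exact openLogRel_papp ihP ihA
  | nabs _ ih => exact openLogRel_nabs ih
  | napp n _ ih => exact openLogRel_napp n ih
  | par_assoc P Q R =>
    refine openLogRel_of_evals (.par_assoc P Q R) fun _ _ ρ σ a ha => ?_
    obtain _ | ⟨_ | ⟨hP, hQ⟩, hR⟩ := ha
    rw [add_assoc]
    exact .par hP (.par hQ hR)
  | par_comm P Q =>
    refine openLogRel_of_evals (.par_comm P Q) fun _ _ ρ σ a ha => ?_
    obtain _ | ⟨hP, hQ⟩ := ha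
    rw [add_comm]
    exact .par hQ hP
  | par_nil P =>
    refine openLogRel_of_evals (.par_nil P) fun _ _ ρ σ a ha => ?_
    obtain _ | ⟨hP, _ | _⟩ := ha
    rwa [add_zero]
  | pbeta P Q =>
    refine openLogRel_of_evals (.pbeta P Q) fun _ _ ρ σ a ha => ?_
    rw [Tm.sub_inst, ← Tm.inst_sub_lift]
    cases ha with
    | pbeta ha => exact ha
  | nbeta P n =>
    refine openLogRel_of_evals (.nbeta P n) fun _ _ ρ σ a ha => ?_
    rw [Tm.sub_ninst, ← Tm.ninst_sub_lift]
    cases ha with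
    | nbeta ha => exact ha

theorem of_sc {P Q : Tm ob Δ Γ T} (h : SC P Q) : NormSC P Q := by
  have h_id := (openLogRel_of_sc h .id _ _ fun _ X => logRel_var X).base
  change NormSC (P.sub .id .id) (Q.sub .id .id) at h_id
  rwa [Tm.sub_id, Tm.sub_id] at h_id

end NormSC

theorem Tm.exists_hasSize (P : Tm ob Δ Γ T) : ∃ n, HasSize P n :=
  (NormSC.of_sc (.refl P)).exists_hasSize

/-! ### The multiset of prime components -/

theorem Tm.exists_evals (P : Tm ob Δ Γ Ty.proc) : ∃ a, Evals P a :=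
  ((NormSC.of_sc (.refl P)).exists_evals rfl).imp fun _ ha => ha.1

/-- The prime components of a process, read off its evaluation. -/
noncomputable def Tm.components (P : Tm ob Δ Γ Ty.proc) : Multiset (Component ob Δ Γ) :=
  P.exists_evals.choose

section Components

variable {P Q R : Tm ob Δ Γ Ty.proc} {p q : Component ob Δ Γ}

theorem Tm.evals_components (P : Tm ob Δ Γ Ty.proc) : Evals P P.components :=
  P.exists_evals.choose_spec

theorem Evals.components_eq {a : Multiset (Component ob Δ Γ)} (h : Evals P a) :
    P.components = a :=
  P.evals_components.unique h

theorem SC.components_eq (h : SC P Q) : P.components = Q.components := by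
  obtain ⟨a, hP, hQ⟩ := (NormSC.of_sc h).exists_evals rfl
  rw [hP.components_eq, hQ.components_eq]

@[simp]
theorem Tm.components_nil : (.nil : Tm ob Δ Γ Ty.proc).components = 0 := Evals.nil.components_eq

@[simp]
theorem Tm.components_par (P Q : Tm ob Δ Γ Ty.proc) :
    (Tm.par P Q).components = P.components + Q.components :=
  (Evals.par P.evals_components Q.evals_components).components_eq

@[simp]
theorem Tm.components_out (m : Nm Δ s) (A : Tm ob Δ Γ (ob s)) :
    (Tm.out m A).components = {.out m A.cls} :=
  (Evals.out m A).components_eq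

@[simp]
theorem Tm.components_inp (m : Nm Δ s) (P : Tm ob Δ (ob s :: Γ) Ty.proc) :
    (Tm.inp m P).components = {.inp m P.cls} :=
  (Evals.inp m P).components_eq

@[simp]
theorem Tm.components_var (X : Var Γ Ty.proc) :
    (.var X : Tm ob Δ Γ Ty.proc).components = {.var X} :=
  (Evals.var X).components_eq

@[simp]
theorem Tm.components_papp (X : Var Γ (Ty.pabs T)) (A : Tm ob Δ Γ T) :
    (Tm.papp (.var X) A).components = {.papp X A.cls} :=
  (Evals.papp X A).components_eq

@[simp]
theorem Tm.components_napp (X : Var Γ (Ty.nabs s)) (d : Nm Δ s) :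
    (.napp (.var X) d : Tm ob Δ Γ Ty.proc).components = {.napp X d} :=
  (Evals.napp X d).components_eq

theorem Component.exists_components_eq (p : Component ob Δ Γ) :
    ∃ P : Tm ob Δ Γ Ty.proc, P.components = {p} := by
  cases p with
  | out m a =>
    obtain ⟨A, rfl⟩ := a.exists_cls_eq
    exact ⟨_, Tm.components_out m A⟩
  | inp m a =>
    obtain ⟨A, rfl⟩ := a.exists_cls_eq
    exact ⟨_, Tm.components_inp m A⟩
  | var X => exact ⟨_, Tm.components_var X⟩
  | papp X a =>
    obtain ⟨A, rfl⟩ := a.exists_cls_eq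
    exact ⟨_, Tm.components_papp X A⟩
  | napp X d => exact ⟨_, Tm.components_napp X d⟩

theorem Tm.exists_components_eq (a : Multiset (Component ob Δ Γ)) :
    ∃ P : Tm ob Δ Γ Ty.proc, P.components = a := by
  induction a using Multiset.induction with
  | empty => exact ⟨_, Tm.components_nil⟩
  | cons p a ih =>
    obtain ⟨P, rfl⟩ := ih
    obtain ⟨Q, hQ⟩ := p.exists_components_eq
    exact ⟨.par Q P, by rw [Tm.components_par, hQ, Multiset.singleton_add]⟩

instance clsZero : Zero (Cls ob Δ Γ Ty.proc) := ⟨Tm.nil.cls⟩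

instance clsAdd : Add (Cls ob Δ Γ Ty.proc) :=
  ⟨Quotient.map₂ Tm.par fun _ _ hP _ _ hQ => SC.par hP hQ⟩

instance clsAddCommMonoid : AddCommMonoid (Cls ob Δ Γ Ty.proc) where
  add_assoc := by
    rintro ⟨P⟩ ⟨Q⟩ ⟨R⟩
    exact Quotient.sound (SC.par_assoc P Q R)
  zero_add := by
    rintro ⟨P⟩
    exact Quotient.sound (SC.par_nil_left P)
  add_zero := by
    rintro ⟨P⟩
    exact Quotient.sound (SC.par_nil P)
  add_comm := by
    rintro ⟨P⟩ ⟨Q⟩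
    exact Quotient.sound (SC.par_comm P Q)
  nsmul := nsmulRec

/-- A prime component as a process, up to structural congruence. -/
def Component.cls : Component ob Δ Γ → Cls ob Δ Γ Ty.proc
  | .out m a => Quotient.map (Tm.out m) (fun _ _ h => SC.out m h) a
  | .inp m a => Quotient.map (Tm.inp m) (fun _ _ h => SC.inp m h) a
  | .var X => (Tm.var X).cls
  | .papp X a => Quotient.map (Tm.papp (.var X)) (fun _ _ h => SC.papp (.refl _) h) a
  | .napp X d => (Tm.napp (.var X) d).cls

theorem Evals.sum_map_cls {P : Tm ob Δ Γ T} {a : Multiset (Component ob Δ Γ)} (h : Evals P a)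
    (hT : T = Ty.proc) : (a.map Component.cls).sum = (hT ▸ P).cls := by
  induction h with
  | nil => rfl
  | par _ _ ihP ihQ =>
    rw [Multiset.map_add, Multiset.sum_add, ihP rfl, ihQ rfl]
    rfl
  | pbeta _ ih => exact (ih rfl).trans (Tm.cls_eq_cls.2 (SC.pbeta _ _).symm)
  | nbeta _ ih => exact (ih rfl).trans (Tm.cls_eq_cls.2 (SC.nbeta _ _).symm)
  | _ =>
    rw [Multiset.map_singleton, Multiset.sum_singleton]
    rfl

theorem Tm.components_eq_iff : P.components = Q.components ↔ SC P Q := by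
  refine ⟨fun h => Tm.cls_eq_cls.1 ?_, SC.components_eq⟩
  calc
    P.cls = (P.components.map Component.cls).sum := (P.evals_components.sum_map_cls rfl).symm
    _ = (Q.components.map Component.cls).sum := by rw [h]
    _ = Q.cls := Q.evals_components.sum_map_cls rfl

theorem Tm.exists_components_eq_cons (h : p ∈ P.components) :
    ∃ P' : Tm ob Δ Γ Ty.proc, P.components = p ::ₘ P'.components := by
  obtain ⟨a, ha⟩ := Multiset.exists_cons_of_mem h
  obtain ⟨P', rfl⟩ := Tm.exists_components_eq a
  exact ⟨P', ha⟩

theorem Tm.components_add_eq_cons (h : P.components + Q.components = p ::ₘ R.components) :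
    (∃ P', P.components = p ::ₘ P'.components ∧ SC R (.par P' Q)) ∨
      ∃ Q', Q.components = p ::ₘ Q'.components ∧ SC R (.par P Q') := by
  have hp : p ∈ P.components + Q.components := h ▸ Multiset.mem_cons_self _ _
  rcases Multiset.mem_add.1 hp with hp | hp
  · obtain ⟨P', hP'⟩ := Tm.exists_components_eq_cons hp
    refine .inl ⟨P', hP', Tm.components_eq_iff.1 ?_⟩
    rw [hP', Multiset.cons_add, Multiset.cons_inj_right] at h
    rw [Tm.components_par, h]
  · obtain ⟨Q', hQ'⟩ := Tm.exists_components_eq_cons hp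
    refine .inr ⟨Q', hQ', Tm.components_eq_iff.1 ?_⟩
    rw [hQ', Multiset.add_cons, Multiset.cons_inj_right] at h
    rw [Tm.components_par, h]

theorem Tm.singleton_eq_cons_components (h : {q} = p ::ₘ R.components) : q = p ∧ SC R .nil := by
  obtain ⟨rfl, hR⟩ := (Multiset.singleton_eq_cons_iff _).1 h
  exact ⟨rfl, Tm.components_eq_iff.1 (hR.trans Tm.components_nil.symm)⟩

theorem Tm.components_eq_cons_iff (hR : R.components = {p}) :
    P.components = p ::ₘ Q.components ↔ SC P (.par R Q) := by
  rw [← Tm.components_eq_iff, Tm.components_par, hR, Multiset.singleton_add]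

end Components

/-! ### Substitution on components -/

/-- Simultaneous substitution on terms up to structural congruence. -/
def Cls.sub (ρ : NSub Δ Δ') (σ : PSub ob Δ' Γ Γ') : Cls ob Δ Γ T → Cls ob Δ' Γ' T :=
  Quotient.map (Tm.sub ρ σ) fun _ _ h => h.sub ρ σ

/-- The components into which a prime component decomposes after a substitution. -/
noncomputable def Component.sub (ρ : NSub Δ Δ') (σ : PSub ob Δ' Γ Γ') :
    Component ob Δ Γ → Multiset (Component ob Δ' Γ')
  | .out m a => {.out (m.nsub ρ) (a.sub ρ σ)}
  | .inp m a => {.inp (m.nsub ρ) (a.sub ρ (σ.lift _))}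
  | .var X => (σ _ X).components
  | .papp X a => (Tm.papp (σ _ X) (a.sub ρ σ).out).components
  | .napp X d => (Tm.napp (σ _ X) (d.nsub ρ)).components

theorem Component.sub_papp (ρ : NSub Δ Δ') (σ : PSub ob Δ' Γ Γ') (X : Var Γ (Ty.pabs T))
    (A : Tm ob Δ Γ T) :
    Component.sub ρ σ (.papp X A.cls) = (Tm.papp (σ _ X) (A.sub ρ σ)).components :=
  (SC.papp (.refl _) (Tm.cls_eq_cls.1 (Quotient.out_eq (A.sub ρ σ).cls))).components_eq

theorem Evals.sub {P : Tm ob Δ Γ T} {a : Multiset (Component ob Δ Γ)} (h : Evals P a)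
    (ρ : NSub Δ Δ') (σ : PSub ob Δ' Γ Γ') :
    Evals (P.sub ρ σ) (a.bind (Component.sub ρ σ)) := by
  induction h with
  | nil => exact .nil
  | par _ _ ihP ihQ =>
    rw [Multiset.add_bind]
    exact .par ihP ihQ
  | out m A =>
    rw [Multiset.singleton_bind]
    exact .out _ _
  | inp m P =>
    rw [Multiset.singleton_bind]
    exact .inp _ _
  | papp X A =>
    rw [Multiset.singleton_bind, Component.sub_papp]
    exact Tm.evals_components _
  | pbeta _ ih =>
    rw [Tm.sub_inst, ← Tm.inst_sub_lift] at ih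
    exact .pbeta ih
  | nbeta _ ih =>
    rw [Tm.sub_ninst, ← Tm.ninst_sub_lift] at ih
    exact .nbeta ih
  | _ =>
    rw [Multiset.singleton_bind]
    exact Tm.evals_components _

theorem Tm.components_sub (P : Tm ob Δ Γ Ty.proc) (ρ : NSub Δ Δ') (σ : PSub ob Δ' Γ Γ') :
    (P.sub ρ σ).components = P.components.bind (Component.sub ρ σ) :=
  (P.evals_components.sub ρ σ).components_eq

/-! ### Transitions and components -/

section Steps

variable {m : Nm Δ s} {A : Tm ob Δ Γ (ob s)} {P P' P₁ : Tm ob Δ Γ Ty.proc}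
  {P₂ : Tm ob Δ (ob s :: Γ) Ty.proc}

theorem OutStep.iff_components :
    OutStep m A P P' ↔ P.components = .out m A.cls ::ₘ P'.components := by
  constructor
  · intro h
    induction h with
    | out => simp
    | parL Q _ ih => simp [ih]
    | parR Q _ ih => simp [ih]
    | struct hP _ hP' ih => rw [hP.components_eq, ih, hP'.components_eq]
  · intro h
    rw [Tm.components_eq_cons_iff (Tm.components_out m A)] at h
    exact .struct h (.parL P' .out) (SC.par_nil_left P')

theorem InStep.iff_components :
    InStep m P P₂ ↔ ∃ (B : Tm ob Δ (ob s :: Γ) Ty.proc) (R : Tm ob Δ Γ Ty.proc),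
      P.components = .inp m B.cls ::ₘ R.components ∧ SC P₂ (.par B (R.wk (ob s))) := by
  constructor
  · intro h
    induction h with
    | inp P => exact ⟨P, .nil, by simp, (SC.par_nil P).symm⟩
    | parL Q _ ih =>
      obtain ⟨B, R, hP, hP₂⟩ := ih
      exact ⟨B, .par R Q, by simp [hP], (SC.par hP₂ (.refl _)).trans (.par_assoc _ _ _)⟩
    | parR Q _ ih =>
      obtain ⟨B, R, hP, hP₂⟩ := ih
      exact ⟨B, .par R Q, by simp [hP, add_comm],
        (SC.par_comm _ _).trans ((SC.par hP₂ (.refl _)).trans (.par_assoc _ _ _))⟩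
    | struct hQ _ hQ' ih =>
      obtain ⟨B, R, hP, hP₂⟩ := ih
      exact ⟨B, R, hQ.components_eq.trans hP, hQ'.symm.trans hP₂⟩
  · rintro ⟨B, R, hP, hP₂⟩
    rw [Tm.components_eq_cons_iff (Tm.components_inp m B)] at hP
    exact .struct hP (.parL R (.inp B)) hP₂.symm

theorem TauStep.exists_outStep_inStep (h : TauStep P P') :
    ∃ (s : S) (m : Nm Δ s) (A : Tm ob Δ Γ (ob s)) (P₁ : Tm ob Δ Γ Ty.proc)
      (P₂ : Tm ob Δ (ob s :: Γ) Ty.proc),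
      OutStep m A P P₁ ∧ InStep m P₁ P₂ ∧ SC P' (P₂.inst A) := by
  induction h with
  | @comL s m A P P' Q Q' hP hQ =>
    refine ⟨s, m, A, _, _, .parL _ hP, .parR _ hQ, ?_⟩
    change SC _ (.par ((P'.wk _).inst A) (Q'.inst A))
    rw [Tm.wk_inst]
    exact .refl _
  | @comR s m A P Q Q' P' hP hQ =>
    refine ⟨s, m, A, _, _, .parR _ hQ, .parL _ hP, ?_⟩
    change SC _ (.par (P'.inst A) ((Q'.wk _).inst A))
    rw [Tm.wk_inst]
    exact .refl _
  | parL Q _ ih =>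
    obtain ⟨s, m, A, P₁, P₂, hP₁, hP₂, hsc⟩ := ih
    refine ⟨s, m, A, _, _, .parL _ hP₁, .parL _ hP₂, ?_⟩
    change SC _ (.par (P₂.inst A) ((Q.wk _).inst A))
    rw [Tm.wk_inst]
    exact .par hsc (.refl _)
  | parR Q _ ih =>
    obtain ⟨s, m, A, P₁, P₂, hP₁, hP₂, hsc⟩ := ih
    refine ⟨s, m, A, _, _, .parR _ hP₁, .parR _ hP₂, ?_⟩
    change SC _ (.par ((Q.wk _).inst A) (P₂.inst A))
    rw [Tm.wk_inst]
    exact .par (.refl _) hsc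
  | struct hQ _ hQ' ih =>
    obtain ⟨s, m, A, P₁, P₂, hP₁, hP₂, hsc⟩ := ih
    exact ⟨s, m, A, P₁, P₂, .struct hQ hP₁ (.refl _), hP₂, hQ'.symm.trans hsc⟩

theorem TauStep.of_outStep_inStep (hP : OutStep m A P P₁) (hP₁ : InStep m P₁ P₂) :
    TauStep P (P₂.inst A) := by
  rw [OutStep.iff_components, Tm.components_eq_cons_iff (Tm.components_out m A)] at hP
  exact .struct hP (.comL .out hP₁) (SC.par_nil_left _)

end Steps

/-! ### Sizes of components -/

/-- The size of a prime component: that of a process consisting of it alone. -/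
def Component.HasSize : Component ob Δ Γ → ℕ → Prop
  | .out _ a, n => ∃ A k, A.cls = a ∧ HOmp.HasSize A k ∧ n = k + 1
  | .inp _ a, n => ∃ A k, A.cls = a ∧ HOmp.HasSize A k ∧ n = k + 1
  | .var _, n => n = 1
  | .papp _ a, n => ∃ A k, A.cls = a ∧ HOmp.HasSize A k ∧ n = k + 1
  | .napp _ _, n => n = 1

/-- In the case of an abstraction: its body has a size less than `n`. -/
def HasBodySizeLT (n : ℕ) : {T : Ty S} → Tm ob Δ Γ T → Prop
  | .proc, _ => True
  | .pabs _, P => ∃ k < n, HasSize P.pbody k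
  | .nabs _, P => ∃ k < n, HasSize P.nbody k

section Sizes

variable {P : Tm ob Δ Γ T} {n : ℕ}

theorem Component.HasSize.pos {p : Component ob Δ Γ} (h : p.HasSize n) : 0 < n := by
  cases p with
  | var X => exact Nat.lt_of_lt_of_eq one_pos (Eq.symm h)
  | napp X d => exact Nat.lt_of_lt_of_eq one_pos (Eq.symm h)
  | _ =>
    obtain ⟨_, _, _, _, rfl⟩ := h
    exact Nat.succ_pos _

theorem HasSize.of_singleton_eq_cons {p q : Component ob Δ Γ} {P' : Tm ob Δ Γ Ty.proc}
    (hq : q.HasSize n) (h : {q} = p ::ₘ P'.components) :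
    ∃ k l, p.HasSize k ∧ HasSize P' l ∧ k + l = n := by
  obtain ⟨rfl, hP'⟩ := Tm.singleton_eq_cons_components h
  exact ⟨n, 0, hq, .congr hP'.symm .nil, rfl⟩

theorem HasSize.of_evals_cons (h : HasSize P n) {p : Component ob Δ Γ}
    {P' : Tm ob Δ Γ Ty.proc} (hP : Evals P (p ::ₘ P'.components)) :
    ∃ k l, p.HasSize k ∧ HasSize P' l ∧ k + l = n := by
  induction h with
  | @congr _ _ T _ _ _ hsc _ ih =>
    cases T with
    | proc => exact ih (hP.components_eq ▸ hsc.components_eq ▸ Tm.evals_components _)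
    | _ => cases hP
  | nil => exact absurd hP.components_eq.symm (by simp)
  | @par _ _ Q R _ _ hQ hR ihQ ihR =>
    have hcomp := (Tm.components_par Q R).symm.trans hP.components_eq
    rcases Tm.components_add_eq_cons hcomp with ⟨Q', hQ', hsc⟩ | ⟨R', hR', hsc⟩
    · obtain ⟨k, l, hk, hl, rfl⟩ := ihQ (hQ' ▸ Q.evals_components)
      exact ⟨k, _, hk, .congr hsc.symm (.par hl hR), by omega⟩
    · obtain ⟨k, l, hk, hl, rfl⟩ := ihR (hR' ▸ R.evals_components)
      exact ⟨k, _, hk, .congr hsc.symm (.par hQ hl), by omega⟩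
  | inp m hB =>
    exact of_singleton_eq_cons (q := .inp m _) ⟨_, _, rfl, hB, rfl⟩
      ((Tm.components_inp _ _).symm.trans hP.components_eq)
  | out m hA =>
    exact of_singleton_eq_cons (q := .out m _) ⟨_, _, rfl, hA, rfl⟩
      ((Tm.components_out _ _).symm.trans hP.components_eq)
  | var X =>
    exact of_singleton_eq_cons (q := .var X) rfl
      ((Tm.components_var _).symm.trans hP.components_eq)
  | papp X hA =>
    exact of_singleton_eq_cons (q := .papp X _) ⟨_, _, rfl, hA, rfl⟩
      ((Tm.components_papp _ _).symm.trans hP.components_eq)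
  | napp X d =>
    exact of_singleton_eq_cons (q := .napp X d) rfl
      ((Tm.components_napp _ _).symm.trans hP.components_eq)
  | _ => cases hP

theorem HasSize.of_components_eq_cons {P P' : Tm ob Δ Γ Ty.proc} (h : HasSize P n)
    {p : Component ob Δ Γ} (hP : P.components = p ::ₘ P'.components) :
    ∃ k l, p.HasSize k ∧ HasSize P' l ∧ k + l = n :=
  h.of_evals_cons (hP ▸ P.evals_components)

theorem HasSize.hasBodySizeLT (h : HasSize P n) : HasBodySizeLT n P := by
  induction h with
  | @congr _ _ T _ _ _ hsc _ ih =>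
    cases T with
    | proc => trivial
    | pabs T => exact ih.imp fun _ hk => ⟨hk.1, .congr hsc.pbody hk.2⟩
    | nabs s => exact ih.imp fun _ hk => ⟨hk.1, .congr hsc.nbody hk.2⟩
  | pabs h _ => exact ⟨_, Nat.lt_succ_self _, h⟩
  | nabs h _ => exact ⟨_, Nat.lt_succ_self _, h⟩
  | _ => trivial

theorem HasSize.sub_ofRen (h : HasSize P n) (ρ : NSub Δ Δ') (r : Ren Γ Γ') :
    HasSize (P.sub ρ (.ofRen r)) n := by
  induction h generalizing Δ' Γ' with
  | congr hsc _ ih => exact .congr (hsc.sub _ _) (ih ρ r)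
  | nil => exact .nil
  | par _ _ ihP ihQ => exact .par (ihP ρ r) (ihQ ρ r)
  | inp m _ ih =>
    refine .inp _ ?_
    rw [PSub.lift_ofRen]
    exact ih ρ _
  | out m _ ih => exact .out _ (ih ρ r)
  | var X => exact .var _
  | papp X _ ih => exact .papp _ (ih ρ r)
  | napp X d => exact .napp _ _
  | pabs _ ih =>
    refine .pabs (.congr (SC.sub_pbody _ _ _).symm ?_)
    rw [PSub.lift_ofRen]
    exact ih ρ _
  | nabs _ ih => exact .nabs (.congr (SC.sub_nbody _ _ _).symm (ih (ρ.lift _) r))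

theorem HasSize.wk (h : HasSize P n) : HasSize (P.wk U) n := by
  rw [Tm.wk, Tm.ren_eq_sub]
  exact h.sub_ofRen _ _

theorem HasSize.of_inStep {m : Nm Δ s} {P : Tm ob Δ Γ Ty.proc}
    {P' : Tm ob Δ (ob s :: Γ) Ty.proc} (h : HasSize P n) (hP : InStep m P P') :
    ∃ k < n, HasSize P' k := by
  obtain ⟨B, R, hcomp, hsc⟩ := InStep.iff_components.1 hP
  obtain ⟨_, l, ⟨B', k, hB', hk, rfl⟩, hl, rfl⟩ := h.of_components_eq_cons hcomp
  exact ⟨k + l, by omega, .congr hsc.symm (.par (.congr (Tm.cls_eq_cls.1 hB') hk) hl.wk)⟩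

end Sizes

/-! ### The HO-IO game on prime components -/

/-- The components that are inputs. -/
def Component.IsInp : Component ob Δ Γ → Prop
  | .inp _ _ => True
  | _ => False

/-- The relation on components other than inputs induced by a relation on terms. -/
inductive Component.Rel (R : TermRel ob) {Δ : List S} {Γ : List (Ty S)} :
    Component ob Δ Γ → Component ob Δ Γ → Prop
  | out {s : S} (m : Nm Δ s) {a b : Cls ob Δ Γ (ob s)} {A B : Tm ob Δ Γ (ob s)} :
      A.cls = a → B.cls = b → R A B → Component.Rel R (.out m a) (.out m b)
  | var (X : Var Γ Ty.proc) : Component.Rel R (.var X) (.var X)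
  | papp {T : Ty S} (X : Var Γ (Ty.pabs T)) {a b : Cls ob Δ Γ T} {A B : Tm ob Δ Γ T} :
      A.cls = a → B.cls = b → R A B → Component.Rel R (.papp X a) (.papp X b)
  | napp {s : S} (X : Var Γ (Ty.nabs s)) (d : Nm Δ s) : Component.Rel R (.napp X d) (.napp X d)

/-- `Q` answers the moves of `P` in the HO-IO game, with results in `R`. -/
structure Answers (R : TermRel ob) (P Q : Tm ob Δ Γ Ty.proc) : Prop where
  component : ∀ (p : Component ob Δ Γ) (P' : Tm ob Δ Γ Ty.proc), ¬ p.IsInp →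
    P.components = p ::ₘ P'.components →
    ∃ (q : Component ob Δ Γ) (Q' : Tm ob Δ Γ Ty.proc),
      Q.components = q ::ₘ Q'.components ∧ Component.Rel R p q ∧ R P' Q'
  inp : ∀ {s : S} (m : Nm Δ s) (P' : Tm ob Δ (ob s :: Γ) Ty.proc), InStep m P P' →
    ∃ Q' : Tm ob Δ (ob s :: Γ) Ty.proc, InStep m Q Q' ∧ R P' Q'

/-- One round of the HO-IO game, at every type. -/
def Progress (R : TermRel ob) : {T : Ty S} → Tm ob Δ Γ T → Tm ob Δ Γ T → Prop
  | .proc, P, Q => Answers R P Q ∧ Answers R Q P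
  | .pabs _, P, Q => R P.pbody Q.pbody
  | .nabs _, P, Q => R P.nbody Q.nbody

/-- Invariance of a relation under structural congruence. -/
def TermRel.RespectsSC (R : TermRel ob) : Prop :=
  ∀ ⦃Δ : List S⦄ ⦃Γ : List (Ty S)⦄ ⦃T : Ty S⦄ ⦃P Q P' Q' : Tm ob Δ Γ T⦄,
    R P Q → SC P P' → SC Q Q' → R P' Q'

section Game

variable {R R' : TermRel ob} {p q : Component ob Δ Γ}

theorem Component.Rel.not_isInp_left (h : Component.Rel R p q) : ¬ p.IsInp := by
  cases h <;> exact id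

theorem Component.Rel.not_isInp_right (h : Component.Rel R p q) : ¬ q.IsInp := by
  cases h <;> exact id

theorem Component.Rel.mono
    (hR : ∀ ⦃Δ : List S⦄ ⦃Γ : List (Ty S)⦄ ⦃T : Ty S⦄ ⦃P Q : Tm ob Δ Γ T⦄, R P Q → R' P Q)
    (h : Component.Rel R p q) : Component.Rel R' p q := by
  cases h with
  | out m hA hB h => exact .out m hA hB (hR h)
  | var X => exact .var X
  | papp X hA hB h => exact .papp X hA hB (hR h)
  | napp X d => exact .napp X d

theorem Component.Rel.symm (hR : R.Symmetric) (h : Component.Rel R p q) :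
    Component.Rel R q p := by
  cases h with
  | out m hA hB h => exact .out m hB hA (hR h)
  | var X => exact .var X
  | papp X hA hB h => exact .papp X hB hA (hR h)
  | napp X d => exact .napp X d

theorem Component.Rel.refl
    (hR : ∀ ⦃Δ : List S⦄ ⦃Γ : List (Ty S)⦄ ⦃T : Ty S⦄ (P : Tm ob Δ Γ T), R P P)
    (h : ¬ p.IsInp) : Component.Rel R p p := by
  cases p with
  | out m a =>
    obtain ⟨A, hA⟩ := a.exists_cls_eq
    exact .out m hA hA (hR A)
  | inp m a => exact absurd trivial h
  | var X => exact .var X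
  | papp X a =>
    obtain ⟨A, hA⟩ := a.exists_cls_eq
    exact .papp X hA hA (hR A)
  | napp X d => exact .napp X d

theorem Answers.mono
    (hR : ∀ ⦃Δ : List S⦄ ⦃Γ : List (Ty S)⦄ ⦃T : Ty S⦄ ⦃P Q : Tm ob Δ Γ T⦄, R P Q → R' P Q)
    {P Q : Tm ob Δ Γ Ty.proc} (h : Answers R P Q) : Answers R' P Q where
  component p P' hp hP := by
    obtain ⟨q, Q', hQ, hpq, hPQ⟩ := h.component p P' hp hP
    exact ⟨q, Q', hQ, hpq.mono hR, hR hPQ⟩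
  inp m P' hP := (h.inp m P' hP).imp fun _ hQ => ⟨hQ.1, hR hQ.2⟩

theorem Answers.congr {P Q P' Q' : Tm ob Δ Γ Ty.proc} (h : Answers R P Q) (hP : SC P P')
    (hQ : SC Q Q') : Answers R P' Q' where
  component p P₁ hp hP₁ := by
    rw [← hQ.components_eq]
    exact h.component p P₁ hp (hP.components_eq.trans hP₁)
  inp m P₁ hP₁ := by
    obtain ⟨Q₁, hQ₁, hPQ⟩ := h.inp m P₁ (.struct hP hP₁ (.refl _))
    exact ⟨Q₁, .struct hQ.symm hQ₁ (.refl _), hPQ⟩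

theorem Progress.mono
    (hR : ∀ ⦃Δ : List S⦄ ⦃Γ : List (Ty S)⦄ ⦃T : Ty S⦄ ⦃P Q : Tm ob Δ Γ T⦄, R P Q → R' P Q)
    {P Q : Tm ob Δ Γ T} (h : Progress R P Q) : Progress R' P Q := by
  cases T with
  | proc => exact ⟨h.1.mono hR, h.2.mono hR⟩
  | pabs T => exact hR h
  | nabs s => exact hR h

theorem Progress.symm (hR : R.Symmetric) {P Q : Tm ob Δ Γ T} (h : Progress R P Q) :
    Progress R Q P := by
  cases T with
  | proc => exact ⟨h.2, h.1⟩
  | pabs T => exact hR h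
  | nabs s => exact hR h

theorem Progress.congr (hR : R.RespectsSC) {P Q P' Q' : Tm ob Δ Γ T} (h : Progress R P Q)
    (hP : SC P P') (hQ : SC Q Q') : Progress R P' Q' := by
  cases T with
  | proc => exact ⟨h.1.congr hP hQ, h.2.congr hQ hP⟩
  | pabs T => exact hR h hP.pbody hQ.pbody
  | nabs s => exact hR h hP.nbody hQ.nbody

theorem IsHOIOBisim.answers
    {R : ∀ {Δ : List S} {Γ : List (Ty S)} {T : Ty S}, Tm ob Δ Γ T → Tm ob Δ Γ T → Prop}
    (hR : IsHOIOBisim R) {P Q : Tm ob Δ Γ Ty.proc} (h : R P Q) :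
    Answers (fun _ _ _ P Q => R P Q) P Q where
  component p P' hp hP := by
    cases p with
    | out m a =>
      obtain ⟨A, rfl⟩ := a.exists_cls_eq
      obtain ⟨B, Q', hQ, hAB, hPQ⟩ := hR.out h m A P' (OutStep.iff_components.2 hP)
      exact ⟨_, Q', OutStep.iff_components.1 hQ, .out m rfl rfl hAB, hPQ⟩
    | inp m a => exact absurd trivial hp
    | var X =>
      obtain ⟨Q', hQ, hPQ⟩ :=
        hR.var h X P' ((Tm.components_eq_cons_iff (Tm.components_var X)).1 hP)
      exact ⟨_, Q', (Tm.components_eq_cons_iff (Tm.components_var X)).2 hQ, .var X, hPQ⟩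
    | papp X a =>
      obtain ⟨A, rfl⟩ := a.exists_cls_eq
      obtain ⟨B, Q', hQ, hAB, hPQ⟩ :=
        hR.papp h X A P' ((Tm.components_eq_cons_iff (Tm.components_papp X A)).1 hP)
      exact ⟨_, Q', (Tm.components_eq_cons_iff (Tm.components_papp X B)).2 hQ,
        .papp X rfl rfl hAB, hPQ⟩
    | napp X d =>
      obtain ⟨Q', hQ, hPQ⟩ :=
        hR.napp h X d P' ((Tm.components_eq_cons_iff (Tm.components_napp X d)).1 hP)
      exact ⟨_, Q', (Tm.components_eq_cons_iff (Tm.components_napp X d)).2 hQ, .napp X d, hPQ⟩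
  inp m P' hP := hR.inp h m P' hP

theorem isHOIOBisim_of_progress (hsymm : R.Symmetric) (hsc : R.RespectsSC)
    (hR : ∀ ⦃Δ : List S⦄ ⦃Γ : List (Ty S)⦄ ⦃T : Ty S⦄ ⦃P Q : Tm ob Δ Γ T⦄, R P Q →
      Progress R P Q) :
    IsHOIOBisim (ob := ob) fun P Q => R P Q where
  symm h := hsymm h
  pabs h := hR h
  nabs h := hR h
  inp h _ m P' hP := (hR h).1.inp m P' hP
  out h _ m A P' hP := by
    obtain ⟨q, Q', hQ, hpq, hPQ⟩ :=
      (hR h).1.component (.out m A.cls) P' id (OutStep.iff_components.1 hP)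
    cases hpq with
    | out _ hA hB hAB =>
      subst hB
      exact ⟨_, Q', OutStep.iff_components.2 hQ, hsc hAB (Tm.cls_eq_cls.1 hA) (.refl _), hPQ⟩
  var h X P' hP := by
    obtain ⟨q, Q', hQ, hpq, hPQ⟩ := (hR h).1.component (.var X) P' id
      ((Tm.components_eq_cons_iff (Tm.components_var X)).2 hP)
    cases hpq
    exact ⟨Q', (Tm.components_eq_cons_iff (Tm.components_var X)).1 hQ, hPQ⟩
  papp h _ X A P' hP := by
    obtain ⟨q, Q', hQ, hpq, hPQ⟩ := (hR h).1.component (.papp X A.cls) P' id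
      ((Tm.components_eq_cons_iff (Tm.components_papp X A)).2 hP)
    cases hpq with
    | papp _ hA hB hAB =>
      subst hB
      exact ⟨_, Q', (Tm.components_eq_cons_iff (Tm.components_papp X _)).1 hQ,
        hsc hAB (Tm.cls_eq_cls.1 hA) (.refl _), hPQ⟩
  napp h _ X d P' hP := by
    obtain ⟨q, Q', hQ, hpq, hPQ⟩ := (hR h).1.component (.napp X d) P' id
      ((Tm.components_eq_cons_iff (Tm.components_napp X d)).2 hP)
    cases hpq
    exact ⟨Q', (Tm.components_eq_cons_iff (Tm.components_napp X d)).1 hQ, hPQ⟩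

/-! ### Coinduction for HO-IO bisimilarity -/

/-- Strong HO-IO bisimilarity as a type-indexed relation. -/
abbrev hoioRel : TermRel ob := fun _ _ _ P Q => HOIOBisimilar P Q

theorem HOIOBisimilar.symm ⦃Δ : List S⦄ ⦃Γ : List (Ty S)⦄ ⦃T : Ty S⦄ ⦃P Q : Tm ob Δ Γ T⦄
    (h : HOIOBisimilar P Q) : HOIOBisimilar Q P := by
  obtain ⟨R, hR, h⟩ := h
  exact ⟨R, hR, hR.symm h⟩

theorem HOIOBisimilar.progress {P Q : Tm ob Δ Γ T} (h : HOIOBisimilar P Q) :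
    Progress hoioRel P Q := by
  obtain ⟨R, hR, h⟩ := h
  refine Progress.mono (R := fun _ _ _ P Q => R P Q) (fun _ _ _ _ _ h => ⟨R, hR, h⟩) ?_
  cases T with
  | proc => exact ⟨hR.answers h, hR.answers (hR.symm h)⟩
  | pabs T => exact hR.pabs h
  | nabs s => exact hR.nabs h

/-- The union of a relation with HO-IO bisimilarity, closed under structural congruence. -/
def UpTo (R : TermRel ob) : TermRel ob := fun _ _ _ P Q =>
  ∃ P' Q', SC P P' ∧ SC Q' Q ∧ (R P' Q' ∨ HOIOBisimilar P' Q')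

theorem UpTo.of_rel {P Q : Tm ob Δ Γ T} (h : R P Q) : UpTo R P Q :=
  ⟨P, Q, .refl _, .refl _, .inl h⟩

theorem UpTo.of_hoioBisimilar ⦃Δ : List S⦄ ⦃Γ : List (Ty S)⦄ ⦃T : Ty S⦄ ⦃P Q : Tm ob Δ Γ T⦄
    (h : HOIOBisimilar P Q) : UpTo R P Q :=
  ⟨P, Q, .refl _, .refl _, .inr h⟩

theorem UpTo.symm (hsymm : R.Symmetric) : (UpTo R).Symmetric :=
  fun _ _ _ _ _ ⟨_, _, hP, hQ, h⟩ =>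
    ⟨_, _, hQ.symm, hP.symm, h.imp (fun h => hsymm h) fun h => h.symm⟩

theorem UpTo.respectsSC : (UpTo R).RespectsSC :=
  fun _ _ _ _ _ _ _ ⟨_, _, hP₁, hQ₁, h⟩ hP hQ => ⟨_, _, hP.symm.trans hP₁, hQ₁.trans hQ, h⟩

theorem HOIOBisimilar.of_upTo (hsymm : R.Symmetric)
    (hR : ∀ ⦃Δ : List S⦄ ⦃Γ : List (Ty S)⦄ ⦃T : Ty S⦄ ⦃P Q : Tm ob Δ Γ T⦄, R P Q →
      Progress (UpTo R) P Q)
    {P Q : Tm ob Δ Γ T} (h : UpTo R P Q) : HOIOBisimilar P Q := by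
  refine ⟨fun P Q => UpTo R P Q,
    isHOIOBisim_of_progress (UpTo.symm hsymm) UpTo.respectsSC ?_, h⟩
  rintro Δ Γ T P Q ⟨P', Q', hP, hQ, h⟩
  have h_progress : Progress (UpTo R) P' Q' :=
    h.elim (fun h => hR h) fun h => h.progress.mono UpTo.of_hoioBisimilar
  exact h_progress.congr UpTo.respectsSC hP.symm hQ

theorem HOIOBisimilar.coinduction (hsymm : R.Symmetric)
    (hR : ∀ ⦃Δ : List S⦄ ⦃Γ : List (Ty S)⦄ ⦃T : Ty S⦄ ⦃P Q : Tm ob Δ Γ T⦄, R P Q →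
      Progress (UpTo R) P Q)
    {P Q : Tm ob Δ Γ T} (h : R P Q) : HOIOBisimilar P Q :=
  .of_upTo hsymm hR (.of_rel h)

theorem HOIOBisimilar.of_progress {P Q : Tm ob Δ Γ T} (h : Progress hoioRel P Q) :
    HOIOBisimilar P Q :=
  .coinduction (R := fun _ _ _ P Q => Progress hoioRel P Q)
    (fun _ _ _ _ _ h => Progress.symm HOIOBisimilar.symm h)
    (fun _ _ _ _ _ h => Progress.mono UpTo.of_hoioBisimilar h) h

theorem SC.answers (hR : ∀ ⦃Δ : List S⦄ ⦃Γ : List (Ty S)⦄ ⦃T : Ty S⦄ (P : Tm ob Δ Γ T), R P P)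
    {P Q : Tm ob Δ Γ Ty.proc} (h : SC P Q) : Answers R P Q where
  component p P' hp hP := ⟨p, P', h.components_eq.symm.trans hP, .refl hR hp, hR P'⟩
  inp _ P' hP := ⟨P', .struct h.symm hP (.refl _), hR P'⟩

theorem HOIOBisimilar.of_sc {P Q : Tm ob Δ Γ T} (h : SC P Q) : HOIOBisimilar P Q := by
  refine .coinduction (R := fun _ _ _ P Q => SC P Q) (fun _ _ _ _ _ h => h.symm) ?_ h
  intro Δ Γ T P Q h
  have h_refl ⦃Δ : List S⦄ ⦃Γ : List (Ty S)⦄ ⦃T : Ty S⦄ (P : Tm ob Δ Γ T) :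
      UpTo (fun _ _ _ P Q => SC P Q) P P := .of_rel (.refl P)
  cases T with
  | proc => exact ⟨h.answers h_refl, h.symm.answers h_refl⟩
  | pabs T => exact .of_rel h.pbody
  | nabs s => exact .of_rel h.nbody

theorem HOIOBisimilar.refl (P : Tm ob Δ Γ T) : HOIOBisimilar P P := .of_sc (.refl P)

theorem HOIOBisimilar.congr {P Q P' Q' : Tm ob Δ Γ T} (h : HOIOBisimilar P Q)
    (hP : SC P P') (hQ : SC Q Q') : HOIOBisimilar P' Q' :=
  .of_upTo (R := fun _ _ _ _ _ => False) (fun _ _ _ _ _ h => h) (fun _ _ _ _ _ h => h.elim)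
    ⟨P, Q, hP.symm, hQ, .inr h⟩

end Game

/-! ### Moves of instances -/

section Instances

variable {ρ : NSub Δ Δ'} {σ σ' : PSub ob Δ' Γ Γ'}

theorem Component.IsInp.exists_sub_eq {p : Component ob Δ Γ} (hp : p.IsInp) (ρ : NSub Δ Δ')
    (σ : PSub ob Δ' Γ Γ') : ∃ p', p.sub ρ σ = {p'} ∧ p'.IsInp := by
  cases p with
  | inp m a => exact ⟨_, rfl, trivial⟩
  | _ => exact hp.elim

theorem Component.IsInp.of_sub_eq_inp {p : Component ob Δ Γ} (hp : p.IsInp) {m : Nm Δ' s}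
    {B : Tm ob Δ' (ob s :: Γ') Ty.proc} (h : p.sub ρ σ = {.inp m B.cls}) :
    ∃ (m₀ : Nm Δ s) (A : Tm ob Δ (ob s :: Γ) Ty.proc),
      p = .inp m₀ A.cls ∧ m₀.nsub ρ = m ∧ SC (A.sub ρ (σ.lift (ob s))) B := by
  cases p with
  | inp m₀ a =>
    obtain ⟨A, rfl⟩ := a.exists_cls_eq
    injection Multiset.singleton_inj.1 h with hs hm hB
    subst hs
    exact ⟨m₀, A, rfl, eq_of_heq hm, Tm.cls_eq_cls.1 (eq_of_heq hB)⟩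
  | _ => exact hp.elim

theorem Tm.components_sub_cons {P P' : Tm ob Δ Γ Ty.proc} {p : Component ob Δ Γ}
    {p' : Component ob Δ' Γ'} (hP : P.components = p ::ₘ P'.components)
    (hp : p.sub ρ σ = {p'}) :
    (P.sub ρ σ).components = p' ::ₘ (P'.sub ρ σ).components := by
  rw [Tm.components_sub, Tm.components_sub, hP, Multiset.cons_bind, hp, Multiset.singleton_add]

theorem Tm.exists_of_components_sub_eq_cons {P : Tm ob Δ Γ Ty.proc} {R : Tm ob Δ' Γ' Ty.proc}
    {p' : Component ob Δ' Γ'}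
    (hsingle : ∀ p ∈ P.components, ∃ p', Component.sub ρ σ p = {p'})
    (h : (P.sub ρ σ).components = p' ::ₘ R.components) :
    ∃ (p : Component ob Δ Γ) (P' : Tm ob Δ Γ Ty.proc),
      P.components = p ::ₘ P'.components ∧ p.sub ρ σ = {p'} ∧ SC R (P'.sub ρ σ) := by
  have hmem : p' ∈ P.components.bind (Component.sub ρ σ) := by
    rw [← Tm.components_sub, h]
    exact Multiset.mem_cons_self _ _
  obtain ⟨p, hp, hpp'⟩ := Multiset.mem_bind.1 hmem
  obtain ⟨p'', hp''⟩ := hsingle p hp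
  obtain rfl : p' = p'' := Multiset.mem_singleton.1 (hp'' ▸ hpp')
  obtain ⟨P', hP'⟩ := Tm.exists_components_eq_cons hp
  refine ⟨p, P', hP', hp'', Tm.components_eq_iff.1 ?_⟩
  rw [Tm.components_sub_cons hP' hp'', Multiset.cons_inj_right] at h
  exact h.symm

theorem InStep.sub {m : Nm Δ s} {P : Tm ob Δ Γ Ty.proc} {P' : Tm ob Δ (ob s :: Γ) Ty.proc}
    (h : InStep m P P') (ρ : NSub Δ Δ') (σ : PSub ob Δ' Γ Γ') :
    InStep (m.nsub ρ) (P.sub ρ σ) (P'.sub ρ (σ.lift (ob s))) := by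
  obtain ⟨B, R, hP, hP'⟩ := InStep.iff_components.1 h
  refine InStep.iff_components.2 ⟨_, _, Tm.components_sub_cons hP rfl, (hP'.sub _ _).trans ?_⟩
  rw [← Tm.wk_sub_lift]
  exact .refl _

theorem InStep.exists_of_sub {m : Nm Δ' s} {P : Tm ob Δ Γ Ty.proc}
    {P'' : Tm ob Δ' (ob s :: Γ') Ty.proc}
    (hnotInp : ∀ p ∈ P.components, ¬ p.IsInp → ∃ p', Component.sub ρ σ p = {p'} ∧ ¬ p'.IsInp)
    (h : InStep m (P.sub ρ σ) P'') :
    ∃ (m₀ : Nm Δ s) (P' : Tm ob Δ (ob s :: Γ) Ty.proc),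
      m₀.nsub ρ = m ∧ InStep m₀ P P' ∧ SC P'' (P'.sub ρ (σ.lift (ob s))) := by
  obtain ⟨B, R, hcomp, hP''⟩ := InStep.iff_components.1 h
  have hsingle (p) (hp : p ∈ P.components) : ∃ p', Component.sub ρ σ p = {p'} := by
    by_cases h_inp : p.IsInp
    · exact (h_inp.exists_sub_eq ρ σ).imp fun _ h => h.1
    · exact (hnotInp p hp h_inp).imp fun _ h => h.1
  obtain ⟨p, P', hP, hp, hR⟩ := Tm.exists_of_components_sub_eq_cons hsingle hcomp
  have h_inp : p.IsInp := by
    by_contra h_inp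
    obtain ⟨p', hp', hp'_inp⟩ := hnotInp p (hP ▸ Multiset.mem_cons_self _ _) h_inp
    obtain rfl := Multiset.singleton_inj.1 (hp.symm.trans hp')
    exact hp'_inp trivial
  obtain ⟨m₀, A, rfl, rfl, hA⟩ := h_inp.of_sub_eq_inp hp
  refine ⟨m₀, .par A (P'.wk _), rfl, InStep.iff_components.2 ⟨A, P', hP, .refl _⟩, ?_⟩
  refine hP''.trans (.par hA.symm ?_)
  change SC _ ((P'.wk _).sub ρ (σ.lift _))
  rw [Tm.wk_sub_lift]
  exact hR.wk

theorem InStep.of_par {m : Nm Δ s} {P Q : Tm ob Δ Γ Ty.proc}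
    {R : Tm ob Δ (ob s :: Γ) Ty.proc} (h : InStep m (.par P Q) R) :
    (∃ P', InStep m P P' ∧ SC R (.par P' (Q.wk _))) ∨
      ∃ Q', InStep m Q Q' ∧ SC R (.par (P.wk _) Q') := by
  obtain ⟨B, R', hcomp, hR⟩ := InStep.iff_components.1 h
  rw [Tm.components_par] at hcomp
  rcases Tm.components_add_eq_cons hcomp with ⟨P', hP, hR'⟩ | ⟨Q', hQ, hR'⟩
  · refine .inl ⟨_, InStep.iff_components.2 ⟨B, P', hP, .refl _⟩, hR.trans ?_⟩
    exact (SC.par (.refl _) hR'.wk).trans (SC.par_assoc _ _ _).symm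
  · refine .inr ⟨_, InStep.iff_components.2 ⟨B, Q', hQ, .refl _⟩, hR.trans ?_⟩
    exact (SC.par (.refl _) (hR'.wk.trans (.par_comm _ _))).trans
      ((SC.par_assoc _ _ _).symm.trans (.par_comm _ _))

end Instances

/-! ### Renamings and parallel compositions of HO-IO bisimilar terms -/

/-- Renamings of HO-IO bisimilar terms. -/
inductive RenRel : TermRel ob
  | mk {Δ Δ' : List S} {Γ Γ' : List (Ty S)} {T : Ty S} {P Q : Tm ob Δ Γ T} (ρ : NSub Δ Δ')
      (r : Ren Γ Γ') : HOIOBisimilar P Q → RenRel (P.sub ρ (.ofRen r)) (Q.sub ρ (.ofRen r))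

theorem Component.exists_sub_ofRen (p : Component ob Δ Γ) (hp : ¬ p.IsInp) (ρ : NSub Δ Δ')
    (r : Ren Γ Γ') : ∃ p', p.sub ρ (.ofRen r) = {p'} ∧ ¬ p'.IsInp := by
  cases p with
  | out m a => exact ⟨_, rfl, id⟩
  | inp m a => exact absurd trivial hp
  | var X => exact ⟨_, Tm.components_var _, id⟩
  | papp X a => exact ⟨_, Tm.components_papp _ _, id⟩
  | napp X d => exact ⟨_, Tm.components_napp _ _, id⟩

theorem Component.exists_sub_ofRen_eq_singleton (p : Component ob Δ Γ) (ρ : NSub Δ Δ')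
    (r : Ren Γ Γ') : ∃ p', p.sub ρ (.ofRen r) = {p'} := by
  by_cases hp : p.IsInp
  · exact (hp.exists_sub_eq ρ _).imp fun _ h => h.1
  · exact (p.exists_sub_ofRen hp ρ r).imp fun _ h => h.1

theorem Component.Rel.sub_ofRen {p q : Component ob Δ Γ} (h : Component.Rel hoioRel p q)
    (ρ : NSub Δ Δ') (r : Ren Γ Γ') :
    ∃ p' q', p.sub ρ (.ofRen r) = {p'} ∧ q.sub ρ (.ofRen r) = {q'} ∧
      Component.Rel RenRel p' q' := by
  cases h with
  | out m hA hB h =>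
    subst hA hB
    exact ⟨_, _, rfl, rfl, .out _ rfl rfl (.mk ρ r h)⟩
  | var X => exact ⟨_, _, Tm.components_var _, Tm.components_var _, .var _⟩
  | papp X hA hB h =>
    subst hA hB
    rw [Component.sub_papp, Component.sub_papp]
    exact ⟨_, _, Tm.components_papp _ _, Tm.components_papp _ _, .papp _ rfl rfl (.mk ρ r h)⟩
  | napp X d => exact ⟨_, _, Tm.components_napp _ _, Tm.components_napp _ _, .napp _ _⟩

theorem Answers.sub_ofRen {P Q : Tm ob Δ Γ Ty.proc} (h : Answers hoioRel P Q) (ρ : NSub Δ Δ')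
    (r : Ren Γ Γ') : Answers (UpTo RenRel) (P.sub ρ (.ofRen r)) (Q.sub ρ (.ofRen r)) where
  component p' P'' hp' hP'' := by
    obtain ⟨p, P', hP, hpp', hP'⟩ := Tm.exists_of_components_sub_eq_cons
      (fun p _ => p.exists_sub_ofRen_eq_singleton ρ r) hP''
    have hp (h_inp : p.IsInp) : False := by
      obtain ⟨q, hpq, hq⟩ := h_inp.exists_sub_eq ρ (.ofRen r)
      obtain rfl := Multiset.singleton_inj.1 (hpp'.symm.trans hpq)
      exact hp' hq
    obtain ⟨q, Q', hQ, hpq, hPQ⟩ := h.component p P' hp hP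
    obtain ⟨_, q', hp_sub, hq_sub, hpq'⟩ := hpq.sub_ofRen ρ r
    obtain rfl := Multiset.singleton_inj.1 (hp_sub.symm.trans hpp')
    exact ⟨q', _, Tm.components_sub_cons hQ hq_sub, hpq'.mono fun _ _ _ _ _ h => .of_rel h,
      _, _, hP', .refl _, .inl (.mk ρ r hPQ)⟩
  inp m P'' hP'' := by
    obtain ⟨m₀, P', rfl, hP, hP'⟩ := hP''.exists_of_sub fun p _ hp => p.exists_sub_ofRen hp ρ r
    obtain ⟨Q', hQ, hPQ⟩ := h.inp m₀ P' hP
    refine ⟨_, hQ.sub ρ _, _, _, hP', .refl _, .inl ?_⟩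
    rw [PSub.lift_ofRen]
    exact .mk ρ _ hPQ

theorem HOIOBisimilar.progress_sub_ofRen {P Q : Tm ob Δ Γ T} (h : HOIOBisimilar P Q)
    (ρ : NSub Δ Δ') (r : Ren Γ Γ') :
    Progress (UpTo RenRel) (P.sub ρ (.ofRen r)) (Q.sub ρ (.ofRen r)) := by
  cases T with
  | proc => exact ⟨h.progress.1.sub_ofRen ρ r, h.progress.2.sub_ofRen ρ r⟩
  | pabs T =>
    refine ⟨_, _, SC.sub_pbody _ _ _, (SC.sub_pbody _ _ _).symm, .inl ?_⟩
    rw [PSub.lift_ofRen]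
    exact .mk ρ _ h.progress
  | nabs s =>
    exact ⟨_, _, SC.sub_nbody _ _ _, (SC.sub_nbody _ _ _).symm,
      .inl (.mk (ρ.lift s) r h.progress)⟩

theorem HOIOBisimilar.sub_ofRen {P Q : Tm ob Δ Γ T} (h : HOIOBisimilar P Q)
    (ρ : NSub Δ Δ') (r : Ren Γ Γ') :
    HOIOBisimilar (P.sub ρ (.ofRen r)) (Q.sub ρ (.ofRen r)) := by
  refine .coinduction (R := RenRel) ?_ ?_ (.mk ρ r h)
  · rintro _ _ _ _ _ ⟨ρ, r, h⟩
    exact .mk ρ r h.symm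
  · rintro _ _ _ _ _ ⟨ρ, r, h⟩
    exact h.progress_sub_ofRen ρ r

theorem HOIOBisimilar.wk {P Q : Tm ob Δ Γ T} (h : HOIOBisimilar P Q) :
    HOIOBisimilar (P.wk U) (Q.wk U) := by
  simp only [Tm.wk, Tm.ren_eq_sub]
  exact h.sub_ofRen _ _

/-- Parallel compositions of HO-IO bisimilar processes. -/
inductive ParRel : TermRel ob
  | mk {Δ : List S} {Γ : List (Ty S)} {P Q P' Q' : Tm ob Δ Γ Ty.proc} : HOIOBisimilar P Q →
      HOIOBisimilar P' Q' → ParRel (.par P P') (.par Q Q')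

theorem HOIOBisimilar.answers_par {P Q P' Q' : Tm ob Δ Γ Ty.proc} (h : HOIOBisimilar P Q)
    (h' : HOIOBisimilar P' Q') : Answers (UpTo ParRel) (.par P P') (.par Q Q') where
  component p R hp hR := by
    rw [Tm.components_par] at hR
    rcases Tm.components_add_eq_cons hR with ⟨P₁, hP, hR⟩ | ⟨P₁, hP, hR⟩
    · obtain ⟨q, Q₁, hQ, hpq, hPQ⟩ := h.progress.1.component p P₁ hp hP
      exact ⟨q, .par Q₁ Q', by rw [Tm.components_par, Tm.components_par, hQ, Multiset.cons_add],
        hpq.mono UpTo.of_hoioBisimilar, _, _, hR, .refl _, .inl (.mk hPQ h')⟩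
    · obtain ⟨q, Q₁, hQ, hpq, hPQ⟩ := h'.progress.1.component p P₁ hp hP
      exact ⟨q, .par Q Q₁, by rw [Tm.components_par, Tm.components_par, hQ, Multiset.add_cons],
        hpq.mono UpTo.of_hoioBisimilar, _, _, hR, .refl _, .inl (.mk h hPQ)⟩
  inp m R hR := by
    rcases hR.of_par with ⟨P₁, hP, hR⟩ | ⟨P₁, hP, hR⟩
    · obtain ⟨Q₁, hQ, hPQ⟩ := h.progress.1.inp m P₁ hP
      exact ⟨_, .parL _ hQ, _, _, hR, .refl _, .inl (.mk hPQ h'.wk)⟩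
    · obtain ⟨Q₁, hQ, hPQ⟩ := h'.progress.1.inp m P₁ hP
      exact ⟨_, .parR _ hQ, _, _, hR, .refl _, .inl (.mk h.wk hPQ)⟩

theorem HOIOBisimilar.par {P Q P' Q' : Tm ob Δ Γ Ty.proc} (h : HOIOBisimilar P Q)
    (h' : HOIOBisimilar P' Q') : HOIOBisimilar (.par P P') (.par Q Q') := by
  refine .coinduction (R := ParRel) ?_ ?_ (.mk h h')
  · rintro _ _ _ _ _ ⟨h, h'⟩
    exact .mk h.symm h'.symm
  · rintro _ _ _ _ _ ⟨h, h'⟩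
    exact ⟨h.answers_par h', h.symm.answers_par h'.symm⟩

theorem Component.Rel.answers {P Q : Tm ob Δ Γ Ty.proc} {p q : Component ob Δ Γ}
    (h : Component.Rel hoioRel p q) (hP : P.components = {p}) (hQ : Q.components = {q}) :
    Answers hoioRel P Q where
  component p' P' _ hP' := by
    obtain ⟨rfl, hsc⟩ := Tm.singleton_eq_cons_components (hP.symm.trans hP')
    exact ⟨q, .nil, by rw [hQ, Tm.components_nil, Multiset.cons_zero], h, .of_sc hsc⟩
  inp m P' hP' := by
    obtain ⟨B, R, hcomp, -⟩ := InStep.iff_components.1 hP'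
    obtain ⟨rfl, -⟩ := Tm.singleton_eq_cons_components (hP.symm.trans hcomp)
    exact absurd trivial h.not_isInp_left

theorem Component.Rel.hoioBisimilar {P Q : Tm ob Δ Γ Ty.proc} {p q : Component ob Δ Γ}
    (h : Component.Rel hoioRel p q) (hP : P.components = {p}) (hQ : Q.components = {q}) :
    HOIOBisimilar P Q :=
  .of_progress ⟨h.answers hP hQ, (h.symm HOIOBisimilar.symm).answers hQ hP⟩

/-! ### Substitutivity -/

section Substitutivity

variable {ρ : NSub Δ Δ'} {σ σ' : PSub ob Δ' Γ Γ'}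

theorem HOIOBisimilar.logRel_var ⦃Δ : List S⦄ ⦃Γ : List (Ty S)⦄ ⦃T : Ty S⦄ (X : Var Γ T) :
    LogRel hoioRel (.var X : Tm ob Δ Γ T) (.var X) := by
  intro Δ' Γ' ρ r
  cases T with
  | proc => exact ⟨.refl _, trivial⟩
  | pabs T =>
    exact ⟨.refl _, fun A A' hA =>
      (Component.Rel.papp _ rfl rfl (LogRel.base hA)).hoioBisimilar (Tm.components_papp _ _)
        (Tm.components_papp _ _)⟩
  | nabs s => exact ⟨.refl _, fun n => .refl _⟩

theorem OpenLogRel.of_pbody {P Q : Tm ob Δ Γ (.pabs T)}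
    (h : OpenLogRel hoioRel P.pbody Q.pbody) : OpenLogRel hoioRel P Q := by
  refine .of_forall fun Δ' Γ' ρ σ σ' hσ => ⟨.of_progress ?_, fun A A' hA => ?_⟩
  · have h_body := (h ρ _ _ (hσ.lift HOIOBisimilar.logRel_var T)).base
    exact h_body.congr (SC.sub_pbody _ _ _).symm (SC.sub_pbody _ _ _).symm
  · exact (h ρ _ _ (hσ.cons hA)).base.congr (SC.papp_sub_pbody _ _ _ _).symm
      (SC.papp_sub_pbody _ _ _ _).symm

theorem OpenLogRel.of_nbody {P Q : Tm ob Δ Γ (.nabs s)}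
    (h : OpenLogRel hoioRel P.nbody Q.nbody) : OpenLogRel hoioRel P Q := by
  refine .of_forall fun Δ' Γ' ρ σ σ' hσ => ⟨.of_progress ?_, fun n => ?_⟩
  · have h_body := (h (ρ.lift s) _ _ (hσ.nlift s)).base
    exact h_body.congr (SC.sub_nbody _ _ _).symm (SC.sub_nbody _ _ _).symm
  · exact (h (.cons n ρ) _ _ hσ).base.congr (SC.napp_sub_nbody _ _ _ _).symm
      (SC.napp_sub_nbody _ _ _ _).symm

theorem Answers.isInp_of_mem {R : TermRel ob} {P Q : Tm ob Δ Γ Ty.proc} (h : Answers R Q P)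
    (hP : ∀ p ∈ P.components, p.IsInp) : ∀ q ∈ Q.components, q.IsInp := by
  intro q hq
  by_contra hq_inp
  obtain ⟨Q', hQ⟩ := Tm.exists_components_eq_cons hq
  obtain ⟨p, P', hP_cons, hqp, -⟩ := h.component q Q' hq_inp hQ
  exact hqp.not_isInp_right (hP p (hP_cons ▸ Multiset.mem_cons_self _ _))

theorem Answers.sub_of_inputs {R : TermRel ob} (hR : R.RespectsSC) {P Q : Tm ob Δ Γ Ty.proc}
    (hP : ∀ p ∈ P.components, p.IsInp)
    (h : ∀ ⦃s : S⦄ (m : Nm Δ s) (P' : Tm ob Δ (ob s :: Γ) Ty.proc), InStep m P P' →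
      ∃ Q', InStep m Q Q' ∧ R (P'.sub ρ (σ.lift _)) (Q'.sub ρ (σ'.lift _))) :
    Answers R (P.sub ρ σ) (Q.sub ρ σ') where
  component p' P'' hp' hP'' := by
    obtain ⟨p, P', hP_cons, hp, -⟩ := Tm.exists_of_components_sub_eq_cons
      (fun p hp => ((hP p hp).exists_sub_eq ρ σ).imp fun _ h => h.1) hP''
    obtain ⟨p'', hp'', hp''_inp⟩ :=
      (hP p (hP_cons ▸ Multiset.mem_cons_self _ _)).exists_sub_eq ρ σ
    obtain rfl := Multiset.singleton_inj.1 (hp.symm.trans hp'')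
    exact absurd hp''_inp hp'
  inp m P'' hP'' := by
    obtain ⟨m₀, P', rfl, hP', hsc⟩ :=
      hP''.exists_of_sub fun p hp hp_inp => absurd (hP p hp) hp_inp
    obtain ⟨Q', hQ', hPQ⟩ := h m₀ P' hP'
    exact ⟨_, hQ'.sub ρ σ', hR hPQ hsc.symm (.refl _)⟩

theorem HOIOBisimilar.sub_of_inputs {P Q : Tm ob Δ Γ Ty.proc} (h : HOIOBisimilar P Q)
    (hP : ∀ p ∈ P.components, p.IsInp)
    (h_cont : ∀ ⦃s : S⦄ ⦃m : Nm Δ s⦄ ⦃P' Q' : Tm ob Δ (ob s :: Γ) Ty.proc⦄, InStep m P P' →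
      HOIOBisimilar P' Q' → OpenLogRel hoioRel P' Q')
    (hσ : PSub.Rel hoioRel σ σ') : HOIOBisimilar (P.sub ρ σ) (Q.sub ρ σ') := by
  have hsc : TermRel.RespectsSC (hoioRel (ob := ob)) := fun _ _ _ _ _ _ _ h hP hQ => h.congr hP hQ
  refine .of_progress ⟨.sub_of_inputs hsc hP fun s m P' hP' => ?_,
    .sub_of_inputs hsc (h.progress.2.isInp_of_mem hP) fun s m Q' hQ' => ?_⟩
  · obtain ⟨Q', hQ', hPQ⟩ := h.progress.1.inp m P' hP'
    exact ⟨Q', hQ', (h_cont hP' hPQ ρ _ _ (hσ.lift logRel_var _)).base⟩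
  · obtain ⟨P', hP', hQP⟩ := h.progress.2.inp m Q' hQ'
    exact ⟨P', hP', (h_cont hP' hQP.symm ρ _ _ (hσ.lift logRel_var _)).base.symm⟩

theorem Component.Rel.mono_of_hasSize {R R' : TermRel ob} {p q : Component ob Δ Γ} {n : ℕ}
    (hp : p.HasSize n)
    (hR : ∀ ⦃T : Ty S⦄ ⦃A B : Tm ob Δ Γ T⦄ ⦃k : ℕ⦄, k < n → HOmp.HasSize A k → R A B → R' A B)
    (h : Component.Rel R p q) : Component.Rel R' p q := by
  cases h with
  | out m hA hB h =>
    obtain ⟨A', k, hA', hk, rfl⟩ := hp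
    exact .out m hA hB (hR k.lt_succ_self (hk.congr (Tm.cls_eq_cls.1 (hA'.trans hA.symm))) h)
  | var X => exact .var X
  | papp X hA hB h =>
    obtain ⟨A', k, hA', hk, rfl⟩ := hp
    exact .papp X hA hB (hR k.lt_succ_self (hk.congr (Tm.cls_eq_cls.1 (hA'.trans hA.symm))) h)
  | napp X d => exact .napp X d

theorem Component.Rel.exists_hoioBisimilar_sub {p q : Component ob Δ Γ}
    (h : Component.Rel (fun _ _ _ A B => OpenLogRel hoioRel A B) p q)
    (hσ : PSub.Rel hoioRel σ σ') :
    ∃ P Q : Tm ob Δ Γ Ty.proc, P.components = {p} ∧ Q.components = {q} ∧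
      HOIOBisimilar (P.sub ρ σ) (Q.sub ρ σ') := by
  cases h with
  | out m hA hB h =>
    subst hA hB
    exact ⟨_, _, Tm.components_out m _, Tm.components_out m _,
      (Component.Rel.out _ rfl rfl (h ρ _ _ hσ).base).hoioBisimilar (Tm.components_out _ _)
        (Tm.components_out _ _)⟩
  | var X => exact ⟨_, _, Tm.components_var X, Tm.components_var X, (hσ _ X).base⟩
  | papp X hA hB h =>
    subst hA hB
    exact ⟨_, _, Tm.components_papp X _, Tm.components_papp X _, (hσ _ X).papp (h ρ _ _ hσ)⟩
  | napp X d => exact ⟨_, _, Tm.components_napp X d, Tm.components_napp X d, (hσ _ X).napp _⟩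

theorem Component.Rel.hoioBisimilar_sub_of_cons {p q : Component ob Δ Γ}
    {P P' Q Q' : Tm ob Δ Γ Ty.proc}
    (h : Component.Rel (fun _ _ _ A B => OpenLogRel hoioRel A B) p q)
    (hP : P.components = p ::ₘ P'.components) (hQ : Q.components = q ::ₘ Q'.components)
    (h_rest : OpenLogRel hoioRel P' Q') (hσ : PSub.Rel hoioRel σ σ') :
    HOIOBisimilar (P.sub ρ σ) (Q.sub ρ σ') := by
  obtain ⟨P₁, Q₁, hp, hq, hPQ⟩ := h.exists_hoioBisimilar_sub (ρ := ρ) hσ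
  exact (hPQ.par (h_rest ρ _ _ hσ).base).congr
    (((Tm.components_eq_cons_iff hp).1 hP).sub ρ σ).symm
    (((Tm.components_eq_cons_iff hq).1 hQ).sub ρ σ').symm

theorem HOIOBisimilar.openLogRel_of_hasSize {P Q : Tm ob Δ Γ T} (h : HOIOBisimilar P Q) {n : ℕ}
    (hn : HasSize P n) : OpenLogRel hoioRel P Q := by
  induction n using Nat.strong_induction_on generalizing Δ Γ T with
  | _ n ih =>
  cases T with
  | pabs T =>
    obtain ⟨k, hk, h_size⟩ := hn.hasBodySizeLT
    exact .of_pbody (ih k hk h.progress h_size)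
  | nabs s =>
    obtain ⟨k, hk, h_size⟩ := hn.hasBodySizeLT
    exact .of_nbody (ih k hk h.progress h_size)
  | proc =>
    refine .of_forall fun Δ' Γ' ρ σ σ' hσ => ⟨?_, trivial⟩
    by_cases hP : ∀ p ∈ P.components, p.IsInp
    · refine h.sub_of_inputs hP (fun s m P' Q' hP' hPQ => ?_) hσ
      obtain ⟨k, hk, h_size⟩ := hn.of_inStep hP'
      exact ih k hk hPQ h_size
    · push Not at hP
      obtain ⟨p, hp, hp_inp⟩ := hP
      obtain ⟨P', hP'⟩ := Tm.exists_components_eq_cons hp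
      obtain ⟨q, Q', hQ', hpq, hPQ⟩ := h.progress.1.component p P' hp_inp hP'
      obtain ⟨k, l, hk, hl, rfl⟩ := hn.of_components_eq_cons hP'
      have h_arg : Component.Rel (fun _ _ _ A B => OpenLogRel hoioRel A B) p q :=
        hpq.mono_of_hasSize hk fun T A B j hj h_size hAB => ih j (by omega) hAB h_size
      exact h_arg.hoioBisimilar_sub_of_cons hP' hQ'
        (ih l (Nat.lt_add_of_pos_left hk.pos) hPQ hl) hσ

theorem HOIOBisimilar.psub {P Q : Tm ob Δ Γ T} (h : HOIOBisimilar P Q) {σ σ' : PSub ob Δ Γ Γ'}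
    (hσ : ∀ T X, HOIOBisimilar (σ T X) (σ' T X)) : HOIOBisimilar (P.psub σ) (Q.psub σ') := by
  have openLogRel {Δ : List S} {Γ : List (Ty S)} {T : Ty S} {P Q : Tm ob Δ Γ T}
      (h : HOIOBisimilar P Q) : OpenLogRel hoioRel P Q := by
    obtain ⟨n, hn⟩ := P.exists_hasSize
    exact h.openLogRel_of_hasSize hn
  have logRel (T X) : LogRel hoioRel (σ T X) (σ' T X) := by
    have h_id := openLogRel (hσ T X) .id .id .id fun _ X => logRel_var X
    rwa [Tm.sub_id, Tm.sub_id] at h_id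
  simp only [Tm.psub_eq_sub]
  exact (openLogRel h _ _ _ logRel).base

theorem HOIOBisimilar.inst {P Q : Tm ob Δ (T :: Γ) U} (h : HOIOBisimilar P Q)
    {A B : Tm ob Δ Γ T} (hAB : HOIOBisimilar A B) : HOIOBisimilar (P.inst A) (Q.inst B) := by
  refine h.psub ?_
  rintro _ (_ | X)
  · exact hAB
  · exact .refl _

end Substitutivity

/-! ### HO-IO bisimilarity is contained in HO bisimilarity -/

theorem HOIOBisimilar.exists_outStep {m : Nm Δ s} {A : Tm ob Δ Γ (ob s)}
    {P P' Q : Tm ob Δ Γ Ty.proc} (h : HOIOBisimilar P Q) (hP : OutStep m A P P') :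
    ∃ B Q', OutStep m B Q Q' ∧ HOIOBisimilar A B ∧ HOIOBisimilar P' Q' := by
  obtain ⟨R, hR, h⟩ := h
  obtain ⟨B, Q', hQ, hAB, hPQ⟩ := hR.out h m A P' hP
  exact ⟨B, Q', hQ, ⟨R, hR, hAB⟩, ⟨R, hR, hPQ⟩⟩

theorem isHOBisim_hoioBisimilar : IsHOBisim (ob := ob) fun P Q => HOIOBisimilar P Q where
  symm h := h.symm
  pabs {_ _ P' Q} h := by
    cases Q with
    | pabs Q' =>
      have h_body : HOIOBisimilar P' Q' := h.progress
      exact ⟨Q', rfl, fun A => h_body.inst (.refl A)⟩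
    | var X => cases X
  nabs {_ _ A Q} h := by
    cases Q with
    | nabs B => exact ⟨B, rfl, h.progress⟩
    | var X => cases X
  out h _ _ _ _ hP := h.exists_outStep hP
  inp h _ m P' hP :=
    (h.progress.1.inp m P' hP).imp fun _ hQ => ⟨hQ.1, fun A => HOIOBisimilar.inst hQ.2 (.refl A)⟩
  tau h P' hP := by
    obtain ⟨s, m, A, P₁, P₂, hP₁, hP₂, hsc⟩ := hP.exists_outStep_inStep
    obtain ⟨B, Q₁, hQ₁, hAB, hPQ₁⟩ := h.exists_outStep hP₁
    obtain ⟨Q₂, hQ₂, hPQ₂⟩ := hPQ₁.progress.1.inp m P₂ hP₂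
    exact ⟨_, .of_outStep_inStep hQ₁ hQ₂,
      (HOIOBisimilar.inst hPQ₂ hAB).congr hsc.symm (.refl _)⟩

theorem HOIOBisimilar.hoBisimilarClosed {P Q : Tm ob Δ [] T} (h : HOIOBisimilar P Q) :
    HOBisimilarClosed P Q :=
  ⟨fun P Q => HOIOBisimilar P Q, isHOBisim_hoioBisimilar, h⟩

theorem HOIOBisimilar.hoBisimilar {P Q : Tm ob Δ Γ T} (h : HOIOBisimilar P Q) :
    HOBisimilar P Q :=
  fun _ => (h.psub fun _ _ => .refl _).hoBisimilarClosed

/-! ### HO bisimilarity on closed terms -/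

section Closed

variable {P P' Q Q' : Tm ob Δ [] Ty.proc}

theorem HOBisimilarClosed.symm {P Q : Tm ob Δ [] T} (h : HOBisimilarClosed P Q) :
    HOBisimilarClosed Q P := by
  obtain ⟨R, hR, h⟩ := h
  exact ⟨R, hR, hR.symm h⟩

theorem HOBisimilarClosed.pbody_inst {P Q : Tm ob Δ [] (.pabs T)} (h : HOBisimilarClosed P Q)
    (A : Tm ob Δ [] T) : HOBisimilarClosed (P.pbody.inst A) (Q.pbody.inst A) := by
  obtain ⟨R, hR, h⟩ := h
  cases P with
  | pabs P' =>
    obtain ⟨Q', rfl, h_body⟩ := hR.pabs h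
    exact ⟨R, hR, h_body A⟩
  | var X => cases X

theorem HOBisimilarClosed.nbody {P Q : Tm ob Δ [] (.nabs s)} (h : HOBisimilarClosed P Q) :
    HOBisimilarClosed P.nbody Q.nbody := by
  obtain ⟨R, hR, h⟩ := h
  cases P with
  | nabs P' =>
    obtain ⟨Q', rfl, h_body⟩ := hR.nabs h
    exact ⟨R, hR, h_body⟩
  | var X => cases X

theorem HOBisimilarClosed.exists_outStep {m : Nm Δ s} {A : Tm ob Δ [] (ob s)}
    (h : HOBisimilarClosed P Q) (hP : OutStep m A P P') :
    ∃ B Q', OutStep m B Q Q' ∧ HOBisimilarClosed A B ∧ HOBisimilarClosed P' Q' := by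
  obtain ⟨R, hR, h⟩ := h
  obtain ⟨B, Q', hQ, hAB, hPQ⟩ := hR.out h m A P' hP
  exact ⟨B, Q', hQ, ⟨R, hR, hAB⟩, ⟨R, hR, hPQ⟩⟩

theorem HOBisimilarClosed.exists_inStep {m : Nm Δ s} {P' : Tm ob Δ [ob s] Ty.proc}
    (h : HOBisimilarClosed P Q) (hP : InStep m P P') :
    ∃ Q', InStep m Q Q' ∧ ∀ A, HOBisimilarClosed (P'.inst A) (Q'.inst A) := by
  obtain ⟨R, hR, h⟩ := h
  obtain ⟨Q', hQ, hPQ⟩ := hR.inp h m P' hP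
  exact ⟨Q', hQ, fun A => ⟨R, hR, hPQ A⟩⟩

theorem HOBisimilarClosed.exists_tauStep (h : HOBisimilarClosed P Q) (hP : TauStep P P') :
    ∃ Q', TauStep Q Q' ∧ HOBisimilarClosed P' Q' := by
  obtain ⟨R, hR, h⟩ := h
  obtain ⟨Q', hQ, hPQ⟩ := hR.tau h P' hP
  exact ⟨Q', hQ, ⟨R, hR, hPQ⟩⟩

theorem isHOBisim_sc_comp_hoBisimilarClosed :
    IsHOBisim (ob := ob) fun P Q => ∃ P₁ Q₁, SC P P₁ ∧ SC Q₁ Q ∧ HOBisimilarClosed P₁ Q₁ where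
  symm := fun ⟨P₁, Q₁, hP, hQ, h⟩ => ⟨Q₁, P₁, hQ.symm, hP.symm, h.symm⟩
  pabs {_ _ _ Q} := fun ⟨_, _, hP, hQ, h⟩ => by
    cases Q with
    | pabs Q' =>
      exact ⟨Q', rfl, fun A => ⟨_, _, hP.pbody.inst A, hQ.pbody.inst A, h.pbody_inst A⟩⟩
    | var X => cases X
  nabs {_ _ _ Q} := fun ⟨_, _, hP, hQ, h⟩ => by
    cases Q with
    | nabs Q' => exact ⟨Q', rfl, _, _, hP.nbody, hQ.nbody, h.nbody⟩
    | var X => cases X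
  out := fun ⟨_, _, hP, hQ, h⟩ _ m A P' hP' => by
    obtain ⟨B, Q', hQ', hAB, hPQ⟩ := h.exists_outStep (.struct hP.symm hP' (.refl _))
    exact ⟨B, Q', .struct hQ.symm hQ' (.refl _), ⟨_, _, .refl _, .refl _, hAB⟩,
      ⟨_, _, .refl _, .refl _, hPQ⟩⟩
  inp := fun ⟨_, _, hP, hQ, h⟩ _ m P' hP' => by
    obtain ⟨Q', hQ', hPQ⟩ := h.exists_inStep (.struct hP.symm hP' (.refl _))
    exact ⟨Q', .struct hQ.symm hQ' (.refl _), fun A => ⟨_, _, .refl _, .refl _, hPQ A⟩⟩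
  tau := fun ⟨_, _, hP, hQ, h⟩ P' hP' => by
    obtain ⟨Q', hQ', hPQ⟩ := h.exists_tauStep (.struct hP.symm hP' (.refl _))
    exact ⟨Q', .struct hQ.symm hQ' (.refl _), _, _, .refl _, .refl _, hPQ⟩

theorem HOBisimilarClosed.congr {P P' Q Q' : Tm ob Δ [] T} (h : HOBisimilarClosed P Q)
    (hP : SC P P') (hQ : SC Q Q') : HOBisimilarClosed P' Q' :=
  ⟨_, isHOBisim_sc_comp_hoBisimilarClosed, P, Q, hP.symm, hQ, h⟩

theorem HOBisimilarClosed.inp_nil_inj {d d' : Nm Δ s}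
    (h : HOBisimilarClosed (.inp d .nil : Tm ob Δ [] Ty.proc) (.inp d' .nil)) : d = d' := by
  obtain ⟨Q', hQ, -⟩ := h.exists_inStep (.inp _)
  obtain ⟨B, R, hcomp, -⟩ := InStep.iff_components.1 hQ
  rw [Tm.components_inp] at hcomp
  injection (Tm.singleton_eq_cons_components hcomp).1 with _ hd
  exact hd.symm

end Closed

/-! ### Triggers -/

/-- An output whose argument has the type carried by the subject only up to an equation, as is the
case for subjects chosen through a section of `ob`. -/
def Tm.outAs : {T : Ty S} → ob s = T → Nm Δ s → Tm ob Δ Γ T → Tm ob Δ Γ Ty.proc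
  | _, rfl, m, A => .out m A

/-- The component of an output `Tm.outAs`. -/
def Component.outAs : {T : Ty S} → ob s = T → Nm Δ s → Cls ob Δ Γ T → Component ob Δ Γ
  | _, rfl, m, a => .out m a

/-- The level of a variable: the length of the scope in which it was introduced. Unlike its index,
it does not change under weakening. -/
def Var.level {α : Type u} : {l : List α} → {a : α} → Var l a → ℕ
  | _ :: l, _, .zero => l.length
  | _, _, .succ X => X.level

theorem Var.level_lt {α : Type u} {l : List α} {a : α} (X : Var l a) : X.level < l.length := by
  induction X with
  | zero => exact Nat.lt_succ_self _
  | succ X ih => exact Nat.lt_succ_of_lt ih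

theorem Var.level_inj {α : Type u} {l : List α} {a b : α} (X : Var l a) (Y : Var l b)
    (h : X.level = Y.level) : (⟨a, X⟩ : Σ a, Var l a) = ⟨b, Y⟩ := by
  induction X with
  | zero =>
    cases Y with
    | zero => rfl
    | succ Y => exact absurd h.symm Y.level_lt.ne
  | succ X ih =>
    cases Y with
    | zero => exact absurd h X.level_lt.ne
    | succ Y => cases ih Y h; rfl

theorem Tm.outAs_sub (h : ob s = T) (m : Nm Δ s) (A : Tm ob Δ Γ T) (ρ : NSub Δ Δ')
    (σ : PSub ob Δ' Γ Γ') :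
    (Tm.outAs h m A).sub ρ σ = Tm.outAs h (m.nsub ρ) (A.sub ρ σ) := by
  subst h
  rfl

theorem Tm.components_outAs (h : ob s = T) (m : Nm Δ s) (A : Tm ob Δ Γ T) :
    (Tm.outAs h m A).components = {Component.outAs h m A.cls} := by
  subst h
  exact Tm.components_out m A

theorem Component.exists_outAs_eq_out (h : ob s = T) (m : Nm Δ s) (a : Cls ob Δ Γ T) :
    ∃ A : Tm ob Δ Γ (ob s), Component.outAs h m a = .out m A.cls := by
  subst h
  exact a.exists_cls_eq.imp fun A hA => congrArg (Component.out m) hA.symm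

section Trigger

variable {sel : Ty S → S} (hsel : ∀ T, ob (sel T) = T)

/-- The trigger of type `T` with index `N`: a closed term that signals its use, and the argument
it is given, by an output at the `N`-th name constant. A name `n` is signalled as the process
`n(X).0`. -/
def trigger (N : ℕ) : (T : Ty S) → Tm ob Δ Γ T
  | .proc => .outAs (hsel .proc) (.const N) .nil
  | .pabs T => .pabs (.outAs (hsel T) (.const N) (.var .zero))
  | .nabs s => .nabs (.outAs (hsel .proc) (.const N) (.inp (s := s) (.var .zero) .nil))

theorem trigger_sub (N : ℕ) (T : Ty S) (ρ : NSub Δ Δ') (σ : PSub ob Δ' Γ Γ') :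
    (trigger hsel N T : Tm ob Δ Γ T).sub ρ σ = trigger hsel N T := by
  cases T with
  | proc => exact Tm.outAs_sub _ _ _ _ _
  | pabs T => exact congrArg Tm.pabs (Tm.outAs_sub _ _ _ ρ (σ.lift T))
  | nabs s => exact congrArg Tm.nabs (Tm.outAs_sub _ _ _ (ρ.lift s) (σ.nlift s))

/-- The closing substitution of triggers with pairwise distinct indices, starting from `N`. -/
def trigSub (N : ℕ) : PSub ob Δ Γ [] := fun T X => trigger hsel (N + X.level) T

theorem trigSub_cons (N : ℕ) (T : Ty S) :
    .cons (trigger hsel (N + Γ.length) T) (trigSub hsel N : PSub ob Δ Γ []) =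
      trigSub hsel N := by
  apply PSub.ext
  rintro _ (_ | X) <;> rfl

theorem trigSub_nlift (N : ℕ) (s : S) :
    (trigSub hsel N : PSub ob Δ Γ []).nlift s = trigSub hsel N := by
  apply PSub.ext
  intro T X
  rw [PSub.nlift, Tm.nsub_eq_sub]
  exact trigger_sub hsel _ T _ _

/-- The image of a component under the substitution of triggers. -/
def Component.trig (N : ℕ) : Component ob Δ Γ → Component ob Δ []
  | .out m a => .out m (a.sub .id (trigSub hsel N))
  | .inp m a => .inp m (a.sub .id ((trigSub hsel N).lift _))
  | .var X => .outAs (hsel .proc) (.const (N + X.level)) Tm.nil.cls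
  | .papp (T := T) X a => .outAs (hsel T) (.const (N + X.level)) (a.sub .id (trigSub hsel N))
  | .napp X d => .outAs (hsel .proc) (.const (N + X.level)) (Tm.inp d .nil).cls

theorem Component.sub_trigSub (N : ℕ) (p : Component ob Δ Γ) :
    p.sub .id (trigSub hsel N) = {p.trig hsel N} := by
  cases p with
  | out m a => simp only [Component.sub, Component.trig, Nm.nsub_id]
  | inp m a => simp only [Component.sub, Component.trig, Nm.nsub_id]
  | var X => exact Tm.components_outAs _ _ _
  | papp X a =>
    obtain ⟨A, rfl⟩ := a.exists_cls_eq
    rw [Component.sub_papp]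
    refine (SC.pbeta _ _).components_eq.trans ?_
    rw [Tm.inst, Tm.psub_eq_sub, Tm.outAs_sub, Tm.components_outAs]
    rfl
  | napp X d =>
    refine (SC.nbeta _ _).components_eq.trans ?_
    rw [Tm.ninst, Tm.nsub_eq_sub, Tm.outAs_sub, Tm.components_outAs, Nm.nsub_id]
    rfl

theorem Component.exists_trig_eq_out (N : ℕ) {p : Component ob Δ Γ} (hp : ¬ p.IsInp) :
    ∃ (s : S) (m : Nm Δ s) (A : Tm ob Δ [] (ob s)), p.trig hsel N = .out m A.cls := by
  cases p with
  | out m a => exact ⟨_, m, exists_outAs_eq_out rfl m _⟩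
  | inp m a => exact absurd trivial hp
  | _ => exact ⟨_, _, exists_outAs_eq_out _ _ _⟩

end Trigger

/-! ### Outputs of closed terms -/

section Outputs

/-- Outputs at the same name of HO bisimilar closed terms. -/
inductive OutRel : Component ob Δ [] → Component ob Δ [] → Prop
  | mk {s : S} (m : Nm Δ s) {a b : Cls ob Δ [] (ob s)} {A B : Tm ob Δ [] (ob s)} :
      A.cls = a → B.cls = b → HOBisimilarClosed A B → OutRel (.out m a) (.out m b)

theorem OutRel.hoBisimilarClosed {hT : ob s = T} {m m' : Nm Δ s} {A B : Tm ob Δ [] T}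
    (h : OutRel (.outAs hT m A.cls) (.outAs hT m' B.cls)) : HOBisimilarClosed A B := by
  subst hT
  cases h with
  | mk m hA hB h => exact h.congr (Tm.cls_eq_cls.1 hA) (Tm.cls_eq_cls.1 hB)

/-- The constant that is the subject of an output. -/
def Component.chan : Component ob Δ Γ → Option ℕ
  | .out (.const n) _ => some n
  | _ => none

/-- The variable at the head of a component. -/
def Component.head : Component ob Δ Γ → Option (Σ T, Var Γ T)
  | .out _ _ => none
  | .inp _ _ => none
  | .var X => some ⟨_, X⟩
  | .papp X _ => some ⟨_, X⟩
  | .napp X _ => some ⟨_, X⟩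

theorem OutRel.chan_eq {p q : Component ob Δ []} (h : OutRel p q) : p.chan = q.chan := by
  obtain ⟨m, -, -, -⟩ := h
  cases m <;> rfl

theorem Component.chan_outAs (h : ob s = T) (n : ℕ) (a : Cls ob Δ Γ T) :
    (Component.outAs h (.const n) a).chan = some n := by
  subst h
  rfl

variable {sel : Ty S → S} {hsel : ∀ T, ob (sel T) = T}

theorem Component.chan_trig (N : ℕ) (p : Component ob Δ Γ) :
    (p.trig hsel N).chan = p.head.elim p.chan fun X => some (N + X.2.level) := by
  cases p with
  | out m a => cases m <;> rfl
  | inp m a => rfl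
  | _ => exact Component.chan_outAs _ _ _

open Filter

theorem Component.head_eq_of_frequently {p q : Component ob Δ Γ}
    (h : ∃ᶠ N in atTop, OutRel (p.trig hsel N) (q.trig hsel N)) : p.head = q.head := by
  have h_chan : ∃ᶠ N in atTop, (p.trig hsel N).chan = (q.trig hsel N).chan :=
    h.mono fun N hN => hN.chan_eq
  have h_fresh (c : Option ℕ) (k : ℕ) : ∀ᶠ N in atTop, c ≠ some (N + k) := by
    filter_upwards [eventually_gt_atTop (c.getD 0)] with N hN
    rintro rfl
    exact absurd hN (by simp)
  simp only [Component.chan_trig] at h_chan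
  rcases hp : p.head with _ | X <;> rcases hq : q.head with _ | Y <;> rw [hp, hq] at h_chan
  · obtain ⟨N, h_eq, h_ne⟩ := (h_chan.and_eventually (h_fresh p.chan Y.2.level)).exists
    exact absurd h_eq h_ne
  · obtain ⟨N, h_eq, h_ne⟩ := (h_chan.and_eventually (h_fresh q.chan X.2.level)).exists
    exact absurd h_eq.symm h_ne
  · obtain ⟨N, hN⟩ := h_chan.exists
    simp only [Option.elim_some, Option.some.injEq, Nat.add_left_cancel_iff] at hN
    exact congrArg some (Var.level_inj X.2 Y.2 hN)

end Outputs

/-! ### Finitely many answers -/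

section Answers

open Filter

variable {ι : Type*} {l : Filter ι} {Q : Tm ob Δ Γ Ty.proc}

theorem exists_frequently_of_components_eq_cons
    {R : ι → Component ob Δ Γ → Tm ob Δ Γ Ty.proc → Prop}
    (hR : ∀ ⦃i q Q₁ Q₂⦄, R i q Q₁ → SC Q₁ Q₂ → R i q Q₂)
    (h : ∃ᶠ i in l, ∃ q Q', Q.components = q ::ₘ Q'.components ∧ R i q Q') :
    ∃ q Q', Q.components = q ::ₘ Q'.components ∧ ∃ᶠ i in l, R i q Q' := by
  obtain ⟨q, hq, h_freq⟩ := (frequently_exists_finite Q.components.finite_toSet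
    (p := fun q i => ∃ Q', Q.components = q ::ₘ Q'.components ∧ R i q Q')).1
    (h.mono fun i ⟨q, Q', hQ, hi⟩ => ⟨q, hQ ▸ Multiset.mem_cons_self _ _, Q', hQ, hi⟩)
  obtain ⟨Q', hQ'⟩ := Tm.exists_components_eq_cons hq
  refine ⟨q, Q', hQ', h_freq.mono fun i ⟨Q₁, hQ₁, hi⟩ => hR hi (Tm.components_eq_iff.1 ?_)⟩
  exact (Multiset.cons_inj_right q).1 (hQ₁.symm.trans hQ')

theorem exists_frequently_of_inStep {m : Nm Δ s} {R : ι → Tm ob Δ (ob s :: Γ) Ty.proc → Prop}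
    (hR : ∀ ⦃i Q₁ Q₂⦄, R i Q₁ → SC Q₁ Q₂ → R i Q₂)
    (h : ∃ᶠ i in l, ∃ Q', InStep m Q Q' ∧ R i Q') :
    ∃ Q', InStep m Q Q' ∧ ∃ᶠ i in l, R i Q' := by
  obtain ⟨q, Q₁, hQ, h_freq⟩ := exists_frequently_of_components_eq_cons
    (R := fun i q Q₁ => ∃ B : Tm ob Δ (ob s :: Γ) Ty.proc,
      q = .inp m B.cls ∧ R i (.par B (Q₁.wk _)))
    (fun i q Q₁ Q₂ ⟨B, hq, hi⟩ hsc => ⟨B, hq, hR hi (.par (.refl _) hsc.wk)⟩)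
    (h.mono fun i ⟨Q', hQ', hi⟩ => by
      obtain ⟨B, Q₁, hQ, hsc⟩ := InStep.iff_components.1 hQ'
      exact ⟨_, Q₁, hQ, B, rfl, hR hi hsc⟩)
  obtain ⟨-, B, rfl, -⟩ := h_freq.exists
  refine ⟨_, InStep.iff_components.2 ⟨B, Q₁, hQ, .refl _⟩, h_freq.mono ?_⟩
  rintro i ⟨B', hB, hi⟩
  injection hB with _ _ hB
  exact hR hi (.par (Tm.cls_eq_cls.1 hB.symm) (.refl _))

end Answers

/-! ### HO bisimilarity is contained in HO-IO bisimilarity -/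

section TrigRel

open Filter

variable {sel : Ty S → S} {hsel : ∀ T, ob (sel T) = T} {N : ℕ}

theorem HOBisimilarClosed.exists_component_of_trig {P P' Q : Tm ob Δ Γ Ty.proc}
    (h : HOBisimilarClosed (P.sub .id (trigSub hsel N)) (Q.sub .id (trigSub hsel N)))
    {p : Component ob Δ Γ} (hp : ¬ p.IsInp) (hP : P.components = p ::ₘ P'.components) :
    ∃ (q : Component ob Δ Γ) (Q' : Tm ob Δ Γ Ty.proc), Q.components = q ::ₘ Q'.components ∧
      OutRel (p.trig hsel N) (q.trig hsel N) ∧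
      HOBisimilarClosed (P'.sub .id (trigSub hsel N)) (Q'.sub .id (trigSub hsel N)) := by
  have hp_sub := p.sub_trigSub hsel N
  obtain ⟨s, m, A, hA⟩ := Component.exists_trig_eq_out hsel N hp
  rw [hA] at hp_sub ⊢
  obtain ⟨B, Q'', hQ'', hAB, hPQ⟩ :=
    h.exists_outStep (OutStep.iff_components.2 (Tm.components_sub_cons hP hp_sub))
  obtain ⟨q, Q', hQ, hq, hsc⟩ := Tm.exists_of_components_sub_eq_cons
    (fun q _ => ⟨_, q.sub_trigSub hsel N⟩) (OutStep.iff_components.1 hQ'')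
  rw [Component.sub_trigSub, Multiset.singleton_inj] at hq
  exact ⟨q, Q', hQ, hq ▸ .mk m rfl rfl hAB, hPQ.congr (.refl _) hsc⟩

theorem HOBisimilarClosed.exists_inStep_of_trig {m : Nm Δ s} {P Q : Tm ob Δ Γ Ty.proc}
    {P' : Tm ob Δ (ob s :: Γ) Ty.proc}
    (h : HOBisimilarClosed (P.sub .id (trigSub hsel N)) (Q.sub .id (trigSub hsel N)))
    (hP : InStep m P P') :
    ∃ Q', InStep m Q Q' ∧
      HOBisimilarClosed (P'.sub .id (trigSub hsel N)) (Q'.sub .id (trigSub hsel N)) := by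
  have hP_sub := hP.sub .id (trigSub hsel N)
  rw [Nm.nsub_id] at hP_sub
  obtain ⟨Q'', hQ'', hPQ⟩ := h.exists_inStep hP_sub
  obtain ⟨m', Q', hm, hQ', hsc⟩ := hQ''.exists_of_sub fun q _ hq => by
    obtain ⟨s', m', A, hA⟩ := Component.exists_trig_eq_out hsel N hq
    exact ⟨_, (q.sub_trigSub hsel N).trans (congrArg _ hA), id⟩
  obtain rfl : m' = m := m'.nsub_id.symm.trans hm
  have h_inst := (hPQ (trigger hsel (N + Γ.length) (ob s))).congr (.refl _) (hsc.inst _)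
  rw [Tm.inst_sub_lift, Tm.inst_sub_lift, trigSub_cons] at h_inst
  exact ⟨Q', hQ', h_inst⟩

variable (hsel) in
/-- The terms that become HO bisimilar under infinitely many substitutions of triggers. With
infinitely many indices available, the constants of the triggers can be told apart from those of the
terms, and a term with finitely many answers to a move gives one of them infinitely often. -/
def TrigRel : TermRel ob := fun _ _ _ P Q => ∃ᶠ N in atTop,
  HOBisimilarClosed (P.sub .id (trigSub hsel N)) (Q.sub .id (trigSub hsel N))

theorem Component.Rel.of_frequently_outRel {p q : Component ob Δ Γ} (hp : ¬ p.IsInp)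
    (h : ∃ᶠ N in atTop, OutRel (p.trig hsel N) (q.trig hsel N)) :
    Component.Rel (TrigRel hsel) p q := by
  have h_head := Component.head_eq_of_frequently h
  obtain ⟨N, hN⟩ := h.exists
  cases p with
  | out m a =>
    cases q with
    | out m' b =>
      obtain ⟨A, rfl⟩ := a.exists_cls_eq
      obtain ⟨B, rfl⟩ := b.exists_cls_eq
      cases hN
      exact .out m rfl rfl (h.mono fun N hN => OutRel.hoBisimilarClosed (hT := rfl) hN)
    | inp m' b => cases hN
    | _ => cases h_head
  | inp m a => exact absurd trivial hp
  | var X =>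
    cases q <;> cases h_head
    exact .var X
  | papp X a =>
    cases q with
    | papp Y b =>
      cases h_head
      obtain ⟨A, rfl⟩ := a.exists_cls_eq
      obtain ⟨B, rfl⟩ := b.exists_cls_eq
      exact .papp X rfl rfl (h.mono fun N hN => OutRel.hoBisimilarClosed hN)
    | _ => cases h_head
  | napp X d =>
    cases q <;> cases h_head
    cases (OutRel.hoBisimilarClosed hN).inp_nil_inj
    exact .napp X d

theorem TrigRel.answers {P Q : Tm ob Δ Γ Ty.proc} (h : TrigRel hsel P Q) :
    Answers (TrigRel hsel) P Q where
  component p P' hp hP := by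
    obtain ⟨q, Q', hQ, h_freq⟩ := exists_frequently_of_components_eq_cons
      (fun _ _ _ _ hN hsc => ⟨hN.1, hN.2.congr (.refl _) (hsc.sub _ _)⟩)
      (h.mono fun N hN => hN.exists_component_of_trig hp hP)
    exact ⟨q, Q', hQ, .of_frequently_outRel hp (h_freq.mono fun _ hN => hN.1),
      h_freq.mono fun _ hN => hN.2⟩
  inp m P' hP :=
    exists_frequently_of_inStep (fun _ _ _ hN hsc => hN.congr (.refl _) (hsc.sub _ _))
      (h.mono fun N hN => hN.exists_inStep_of_trig hP)

theorem TrigRel.symm {P Q : Tm ob Δ Γ T} (h : TrigRel hsel P Q) : TrigRel hsel Q P :=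
  h.mono fun _ hN => hN.symm

theorem TrigRel.progress {P Q : Tm ob Δ Γ T} (h : TrigRel hsel P Q) :
    Progress (TrigRel hsel) P Q := by
  cases T with
  | proc => exact ⟨h.answers, h.symm.answers⟩
  | pabs T =>
    refine h.mono fun N hN => ?_
    have h_inst := (hN.pbody_inst (trigger hsel (N + Γ.length) T)).congr
      ((SC.sub_pbody _ _ _).inst _) ((SC.sub_pbody _ _ _).inst _)
    rwa [Tm.inst_sub_lift, Tm.inst_sub_lift, trigSub_cons] at h_inst
  | nabs s =>
    refine h.mono fun N hN => ?_
    have h_body := hN.nbody.congr (SC.sub_nbody _ _ _) (SC.sub_nbody _ _ _)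
    rwa [NSub.lift_id, trigSub_nlift] at h_body

theorem TrigRel.hoioBisimilar {P Q : Tm ob Δ Γ T} (h : TrigRel hsel P Q) :
    HOIOBisimilar P Q :=
  .coinduction (R := TrigRel hsel) (fun _ _ _ _ _ h => h.symm)
    (fun _ _ _ _ _ h => h.progress.mono fun _ _ _ _ _ h => .of_rel h) h

end TrigRel

theorem HOBisimilar.hoioBisimilar (hob : Function.Surjective ob) {P Q : Tm ob Δ Γ T}
    (h : HOBisimilar P Q) : HOIOBisimilar P Q := by
  refine TrigRel.hoioBisimilar (hsel := Function.rightInverse_surjInv hob)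
    (Filter.Frequently.of_forall fun N => ?_)
  simp only [← Tm.psub_eq_sub]
  exact h _

theorem HOBisimilarClosed.hoBisimilar {P Q : Tm ob Δ [] T} (h : HOBisimilarClosed P Q) :
    HOBisimilar P Q := by
  intro σ
  obtain rfl : σ = .id := PSub.ext fun _ X => by cases X
  rwa [Tm.psub_id, Tm.psub_id]

end HOmp

theorem mainTheorem3 {S : Type*} (ob : S → HOmp.Ty S) (hob : Function.Surjective ob) :
    (∀ {Δ : List S} {T : HOmp.Ty S} (P Q : HOmp.Tm ob Δ [] T),
      HOmp.HOBisimilarClosed P Q ↔ HOmp.HOIOBisimilar P Q) ∧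
    (∀ {Δ : List S} {Γ : List (HOmp.Ty S)} {T : HOmp.Ty S} (P Q : HOmp.Tm ob Δ Γ T),
      HOmp.HOBisimilar P Q ↔ HOmp.HOIOBisimilar P Q) :=
  ⟨fun _ _ => ⟨fun h => h.hoBisimilar.hoioBisimilar hob, fun h => h.hoBisimilarClosed⟩,
    fun _ _ => ⟨fun h => h.hoioBisimilar hob, fun h => h.hoBisimilar⟩⟩
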